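/- Let $S$ be a compact connected Riemann surface and let $L$ be a smooth complex line bundle over $S$. Let a finite group $G$ act faithfully on $S$ by a Klein action, i.e. every $g\in G$ acts on $S$ by a holomorphic or an antiholomorphic automorphism. Let there be given a smooth Klein action of $G$ on $L$, i.e. an action of $G$ on the total space of $L$ by smooth maps, lying over the action of $G$ on $S$, such that every $g\in G$ maps fibres to fibres either complex linearly or antilinearly, and $g$ acts antilinearly on $L$ if and only if $g$ acts antiholomorphically on $S$. Then there is a structure of a holomorphic line bundle on $L$, compatible with the given smooth complex line bundle structure (i.e. its holomorphic local trivializations are smooth local trivializations of $L$), such that the smooth Klein action of $G$ on $L$ is a Klein action: every $g\in G$ acts on the total space of the holomorphic line bundle $L$ by a holomorphic or an antiholomorphic automorphism. -/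

import Mathlib

open Bundle Manifold
open scoped ContDiff ComplexConjugate

universe u v w

/- ### Antiholomorphic maps -/

section Antiholomorphic

variable {E : Type*} [NormedAddCommGroup E] [NormedSpace ℂ E]
  {H : Type*} [TopologicalSpace H] (I : ModelWithCorners ℂ E H)
  {M : Type*} [TopologicalSpace M] [ChartedSpace H M]
  {E' : Type*} [NormedAddCommGroup E'] [NormedSpace ℂ E']
  {H' : Type*} [TopologicalSpace H'] (I' : ModelWithCorners ℂ E' H')
  {M' : Type*} [TopologicalSpace M'] [ChartedSpace H' M']

/-- A map between complex manifolds is antiholomorphic if it is continuous and, read in charts, it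
is real differentiable at every point with a conjugate-linear differential. This is `MDifferentiable`
(holomorphy, when the base field is `ℂ`) with "linear" replaced by "conjugate-linear". -/
def MAntiholomorphic (f : M → M') : Prop :=
  ∀ x : M, ContinuousAt f x ∧
    ∃ f' : E →L[ℝ] E', (∀ (c : ℂ) (y : E), f' (c • y) = conj c • f' y) ∧
      HasFDerivWithinAt (writtenInExtChartAt I I' x f) f' (Set.range I) (extChartAt I x x)

end Antiholomorphic

/- ### Complex vector bundles are real vector bundles -/

section RestrictScalars

variable {B : Type*} [TopologicalSpace B] (L : B → Type*)
  [∀ x, AddCommGroup (L x)] [∀ x, Module ℂ (L x)] [TopologicalSpace (TotalSpace ℂ L)]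

theorem trivialization_isLinear_real (e : Trivialization ℂ (π ℂ L)) [h : e.IsLinear ℂ] :
    e.IsLinear ℝ where
  linear b hb :=
    { map_add := (h.linear b hb).map_add
      map_smul := fun c y => by
        have := (h.linear b hb).map_smul (c : ℂ) y
        simpa using this }

/-- A complex line bundle is a real vector bundle (of rank two) by restriction of scalars; the local
trivializations are the same. -/
instance vectorBundle_real [∀ x, TopologicalSpace (L x)] [FiberBundle ℂ L]
    [VectorBundle ℂ ℂ L] : VectorBundle ℝ ℂ L where
  trivialization_linear' e _ := trivialization_isLinear_real L e
  continuousOn_coordChange' e e' _ _ := by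
    have := trivialization_isLinear_real L e
    have := trivialization_isLinear_real L e'
    have h := (ContinuousLinearMap.restrictScalarsL ℂ ℂ ℂ ℝ ℝ).continuous.comp_continuousOn
      (continuousOn_coordChange ℂ e e')
    refine h.congr fun b hb => ?_
    ext y
    simp [Trivialization.coordChangeL_apply' _ _ hb]

end RestrictScalars

/- ### Klein actions on Riemann surfaces and on line bundles -/

section Klein

variable (G : Type w) [Group G] {S : Type u} [TopologicalSpace S] [ChartedSpace ℂ S]

variable (S) in
/-- A Klein action of `G` on a Riemann surface: every element acts by a holomorphic or an
antiholomorphic automorphism. -/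
def IsKleinAction [MulAction G S] : Prop :=
  ∀ g : G, MDifferentiable 𝓘(ℂ, ℂ) 𝓘(ℂ, ℂ) (fun x : S => g • x) ∨
    MAntiholomorphic 𝓘(ℂ, ℂ) 𝓘(ℂ, ℂ) (fun x : S => g • x)

variable (L : S → Type v) [∀ x, AddCommGroup (L x)] [∀ x, Module ℂ (L x)]

/-- `g` maps each fibre `L x` to the fibre `L (g • x)`, by a complex linear map. -/
def ActsLinearly {G : Type w} [Group G] [MulAction G S] [MulAction G (TotalSpace ℂ L)]
    (g : G) : Prop :=
  ∀ x : S, ∃ T : L x →ₗ[ℂ] L (g • x),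
    ∀ y : L x, g • (⟨x, y⟩ : TotalSpace ℂ L) = ⟨g • x, T y⟩

/-- `g` maps each fibre `L x` to the fibre `L (g • x)`, by a conjugate-linear map. -/
def ActsAntilinearly {G : Type w} [Group G] [MulAction G S] [MulAction G (TotalSpace ℂ L)]
    (g : G) : Prop :=
  ∀ x : S, ∃ T : L x →ₛₗ[starRingEnd ℂ] L (g • x),
    ∀ y : L x, g • (⟨x, y⟩ : TotalSpace ℂ L) = ⟨g • x, T y⟩

variable [∀ x, TopologicalSpace (L x)] [TopologicalSpace (TotalSpace ℂ L)]

/-- A smooth Klein action of `G` on the smooth complex line bundle `L`, over a given action of `G`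
on `S`: an action on the total space by (real) smooth maps that send fibres to fibres linearly or
antilinearly, and antilinearly exactly for those `g` that act antiholomorphically on `S`. -/
structure IsSmoothKleinAction [FiberBundle ℂ L] [MulAction G S]
    [MulAction G (TotalSpace ℂ L)] : Prop where
  smooth : ∀ g : G, ContMDiff (𝓘(ℝ, ℂ).prod 𝓘(ℝ, ℂ)) (𝓘(ℝ, ℂ).prod 𝓘(ℝ, ℂ)) ∞
    (fun p : TotalSpace ℂ L => g • p)
  fiberwise : ∀ g : G, ActsLinearly L g ∨ ActsAntilinearly L g
  antilinear_iff : ∀ g : G, ActsAntilinearly L g ↔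
    MAntiholomorphic 𝓘(ℂ, ℂ) 𝓘(ℂ, ℂ) (fun x : S => g • x)

/-- A structure of holomorphic line bundle on the family of complex lines `L`, with the given
topology on its total space: a family of linear local trivializations whose coordinate changes are
holomorphic. -/
structure HolomorphicLineBundleStructure where
  fiberBundle : FiberBundle ℂ L
  vectorBundle : VectorBundle ℂ ℂ L
  holomorphic : ContMDiffVectorBundle ω ℂ L 𝓘(ℂ, ℂ)

namespace HolomorphicLineBundleStructure

variable {L} (h : HolomorphicLineBundleStructure L)

/-- Holomorphy of a self-map of the total space, for the complex manifold structure on the total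
space given by `h`. -/
def IsHolomorphicMap (f : TotalSpace ℂ L → TotalSpace ℂ L) : Prop :=
  letI := h.fiberBundle
  MDifferentiable (𝓘(ℂ, ℂ).prod 𝓘(ℂ, ℂ)) (𝓘(ℂ, ℂ).prod 𝓘(ℂ, ℂ)) f

/-- Antiholomorphy of a self-map of the total space, for the complex manifold structure on the total
space given by `h`. -/
def IsAntiholomorphicMap (f : TotalSpace ℂ L → TotalSpace ℂ L) : Prop :=
  letI := h.fiberBundle
  MAntiholomorphic (𝓘(ℂ, ℂ).prod 𝓘(ℂ, ℂ)) (𝓘(ℂ, ℂ).prod 𝓘(ℂ, ℂ)) f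

/-- The holomorphic structure `h` is a structure on the *smooth* line bundle `L` (whose smooth
structure is the instance `FiberBundle ℂ L`): the holomorphic local trivializations are
diffeomorphisms for that smooth structure. -/
def IsCompatible [FiberBundle ℂ L] : Prop :=
  ∀ e ∈ h.fiberBundle.trivializationAtlas',
    ContMDiffOn (𝓘(ℝ, ℂ).prod 𝓘(ℝ, ℂ)) (𝓘(ℝ, ℂ).prod 𝓘(ℝ, ℂ)) ∞ e e.source ∧
    ContMDiffOn (𝓘(ℝ, ℂ).prod 𝓘(ℝ, ℂ)) (𝓘(ℝ, ℂ).prod 𝓘(ℝ, ℂ)) ∞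
      e.toOpenPartialHomeomorph.symm e.target

/-- The action of `G` on `L` is a Klein action for the holomorphic structure `h`: it is a smooth
Klein action and every element acts on the total space by a holomorphic or antiholomorphic
automorphism. -/
structure IsKleinAction [FiberBundle ℂ L] [MulAction G S] [MulAction G (TotalSpace ℂ L)] :
    Prop extends IsSmoothKleinAction G L where
  holomorphic_or_antiholomorphic : ∀ g : G, h.IsHolomorphicMap (fun p => g • p) ∨
    h.IsAntiholomorphicMap (fun p => g • p)

end HolomorphicLineBundleStructure

end Klein

/-! A holomorphic structure on a smooth line bundle amounts to a `∂̄`-operator: on a curve there is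
no integrability condition, and the holomorphic fibre coordinates are those whose connection form
vanishes. Each smooth fibre coordinate `ψ j` gives a trivial operator over its domain. Weighted by a
partition of unity `ρ j`, these average to a global operator, with form `∑ ρ j · dbarLog (φ / ψ j)`
in a coordinate `φ` (`connForm`). Taking all `G`-translates of the `ψ j`, with weights divided by
`|G|`, makes the operator `G`-invariant.

Flat coordinates exist near every point (`IsCoordCover.exists_flat`): replacing `φ` by `exp u · φ`
adds `dbar u` to the form, so it suffices to solve a planar inhomogeneous Cauchy-Riemann equation,
which convolution with the Cauchy kernel does (`exists_contDiff_dbar_eq`). Ratios of flat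
coordinates are holomorphic (`mdifferentiableAt_coordRatio_of_flat`), so flat coordinates form a
holomorphic atlas. By invariance, translates of flat coordinates are flat
(`connForm_translateCoord`), so in flat coordinates `g` acts on fibres as a holomorphic factor times
`w` or `conj w`. -/

set_option linter.unusedSectionVars false

/-! ### The inhomogeneous Cauchy-Riemann equation in the plane. -/

section Planar

open MeasureTheory Set Complex

theorem integrableOn_Ioi_prod_Ioo_of_continuous {F : ℝ × ℝ → ℂ} (hF : Continuous F) {R : ℝ}
    (hR : ∀ r θ, R ≤ r → F (r, θ) = 0) (a b : ℝ) :
    IntegrableOn F (Ioi 0 ×ˢ Ioo a b) (volume.prod volume) := by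
  have h1 : IntegrableOn F (Icc 0 R ×ˢ Icc a b) (volume.prod volume) :=
    hF.continuousOn.integrableOn_compact (isCompact_Icc.prod isCompact_Icc)
  refine IntegrableOn.of_forall_sdiff_eq_zero (h1.mono_set (s := Ioc 0 R ×ˢ Ioo a b) ?_) ?_ ?_
  · exact prod_mono Ioc_subset_Icc_self Ioo_subset_Icc_self
  · exact measurableSet_Ioi.prod measurableSet_Ioo
  · rintro ⟨r, θ⟩ ⟨⟨h0, h2⟩, h3⟩
    refine hR r θ ?_
    by_contra! h
    exact h3 ⟨⟨h0, h.le⟩, h2⟩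

/-- The polar Jacobian `r` cancels the singularity `1 / r`. -/
theorem locallyIntegrable_inv : LocallyIntegrable (fun z : ℂ => z⁻¹) := by
  rw [MeasureTheory.locallyIntegrable_iff]
  intro K hK
  obtain ⟨R, hR⟩ := hK.isBounded.exists_norm_le
  have h : Integrable (fun z : ℂ => (Iic R).indicator (fun r : ℝ => r⁻¹) ‖z‖) := by
    rw [integrable_fun_norm_addHaar (μ := volume) (E := ℂ) (f := (Iic R).indicator (fun r : ℝ => r⁻¹))]
    have h1 : IntegrableOn (fun _ : ℝ => (1 : ℝ)) (Ioc 0 R) := by simp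
    refine IntegrableOn.of_forall_sdiff_eq_zero (s := Ioc 0 R) ?_ measurableSet_Ioi ?_
    · refine h1.congr_fun (fun y hy => ?_) measurableSet_Ioc
      simp [indicator, hy.2, hy.1.ne']
    · rintro y ⟨hy, h2⟩
      have : ¬ y ≤ R := fun h => h2 ⟨hy, h⟩
      simp [indicator, this]
  have h2 : IntegrableOn (fun z : ℂ => ‖z⁻¹‖) K := by
    refine (h.integrableOn (s := K)).congr_fun (fun z hz => ?_) hK.measurableSet
    simp [indicator, hR z hz]
  exact (integrable_norm_iff (by fun_prop)).1 h2

/-- The combination kills the complex linear part of `D` and doubles the conjugate-linear part,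
which is determined by its value at `1`. -/
theorem apply_add_I_mul_apply_I_mul (D : ℂ →L[ℝ] ℂ) (c : ℂ) :
    D c + I * D (I * c) = conj c * (D 1 + I * D I) := by
  have h : ∀ z : ℂ, D z = z.re * D 1 + z.im * D I := fun z => by
    conv_lhs => rw [show z = z.re • (1 : ℂ) + z.im • I by simp [re_add_im]]
    rw [map_add, map_smul, map_smul]; simp
  rw [h c, h (I * c), show conj c = c.re - c.im * I by
    apply Complex.ext <;> simp]
  simp only [mul_re, mul_im, I_re, I_im]
  push_cast
  linear_combination (c.im * D I ) * I_sq

/-- Cauchy-Pompeiu at the origin. In polar coordinates the integrand becomes `∂B/∂r + (i/r) ∂B/∂θ`: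
the radial term integrates to `-B 0` along each ray, the angular one to zero around each circle by
periodicity. -/
theorem integral_inv_mul_dbar {B : ℂ → ℂ} (hB : ContDiff ℝ 1 B) (hc : HasCompactSupport B) :
    ∫ z : ℂ, z⁻¹ * (fderiv ℝ B z 1 + I * fderiv ℝ B z I) = - (2 * Real.pi * B 0) := by
  rw [← Complex.integral_comp_polarCoord_symm]
  obtain ⟨R, hR⟩ := hc.isCompact.isBounded.exists_norm_le
  set e : ℝ → ℂ := fun θ => Real.cos θ + Real.sin θ * I with he
  have hen : ∀ θ, ‖e θ‖ = 1 := fun θ => by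
    simp only [he]; push_cast; rw [← exp_mul_I, norm_exp_ofReal_mul_I]
  have hec : Continuous e := by fun_prop
  have hed : ∀ θ, HasDerivAt e (I * e θ) θ := fun θ => by
    have := ((Real.hasDerivAt_cos θ).ofReal_comp).add
      (((Real.hasDerivAt_sin θ).ofReal_comp).mul_const I)
    convert! this using 1
    simp only [he]; push_cast; linear_combination (Complex.sin θ) * I_sq
  have hdc : Continuous (fderiv ℝ B) := hB.continuous_fderiv one_ne_zero
  have hdz : ∀ r θ, |R| + 1 ≤ r → fderiv ℝ B (r * e θ) = 0 := fun r θ hr => by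
    by_contra h
    have h1 := hR _ (support_fderiv_subset ℝ h)
    rw [norm_mul, hen, mul_one, norm_real, Real.norm_eq_abs] at h1
    have := le_abs_self r; have := le_abs_self R
    linarith
  set F₁ : ℝ × ℝ → ℂ := fun p => fderiv ℝ B (p.1 * e p.2) (e p.2) with hF₁
  set F₂ : ℝ × ℝ → ℂ := fun p => I * fderiv ℝ B (p.1 * e p.2) (I * e p.2) with hF₂
  have hi₁ := integrableOn_Ioi_prod_Ioo_of_continuous (F := F₁) (R := |R| + 1)
    (by simp only [hF₁]; fun_prop) (fun r θ h => by simp [hF₁, hdz r θ h]) (-Real.pi) Real.pi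
  have hi₂ := integrableOn_Ioi_prod_Ioo_of_continuous (F := F₂) (R := |R| + 1)
    (by simp only [hF₂]; fun_prop) (fun r θ h => by simp [hF₂, hdz r θ h]) (-Real.pi) Real.pi
  have hmain : ∀ p ∈ polarCoord.target, p.1 • ((Complex.polarCoord.symm p)⁻¹ *
      (fderiv ℝ B (Complex.polarCoord.symm p) 1 + I * fderiv ℝ B (Complex.polarCoord.symm p) I)) =
      F₁ p + F₂ p := by
    rintro ⟨r, θ⟩ hp
    have hr : (0 : ℝ) < r := hp.1
    rw [Complex.polarCoord_symm_apply]
    have h1 := apply_add_I_mul_apply_I_mul (fderiv ℝ B (r * e θ)) (e θ)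
    have h2 : (e θ)⁻¹ = conj (e θ) := by
      rw [Complex.inv_def, Complex.normSq_eq_norm_sq, hen]; simp
    simp only [hF₁, hF₂, h1]
    change r • ((r * e θ)⁻¹ * (fderiv ℝ B (r * e θ) 1 + I * fderiv ℝ B (r * e θ) I)) = _
    rw [mul_inv, h2, real_smul]
    have : (r : ℂ) ≠ 0 := ofReal_ne_zero.2 hr.ne'
    field_simp
  rw [setIntegral_congr_fun polarCoord.open_target.measurableSet hmain, polarCoord_target,
    Measure.volume_eq_prod, integral_add hi₁ hi₂]
  have e1 : ∫ p in Ioi (0 : ℝ) ×ˢ Ioo (-Real.pi) Real.pi, F₁ p ∂(volume.prod volume) =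
      - (2 * Real.pi * B 0) := by
    rw [← Measure.prod_restrict, integral_prod_symm _ (by rwa [Measure.prod_restrict])]
    have : ∀ θ : ℝ, ∫ r in Ioi (0 : ℝ), F₁ (r, θ) = - B 0 := fun θ => by
      have hd : ∀ r : ℝ, HasDerivAt (fun r : ℝ => B (r * e θ)) (F₁ (r, θ)) r := fun r => by
        have h1 : HasDerivAt (fun r : ℝ => (r : ℂ) * e θ) (e θ) r := by
          simpa using (hasDerivAt_id r).ofReal_comp.mul_const (e θ)
        exact (hB.differentiable one_ne_zero _).hasFDerivAt.comp_hasDerivAt r h1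
      have := integral_Ioi_of_hasDerivAt_of_tendsto' (a := 0) (f := fun r : ℝ => B (r * e θ))
        (f' := fun r => F₁ (r, θ)) (m := 0) (fun r _ => hd r) ?_ ?_
      · simpa using this
      · have h1 : IntegrableOn (fun r => F₁ (r, θ)) (Icc 0 (|R| + 1)) :=
          (by simp only [hF₁]; fun_prop : Continuous fun r => F₁ (r, θ)).continuousOn.integrableOn_compact
            isCompact_Icc
        refine IntegrableOn.of_forall_sdiff_eq_zero h1 measurableSet_Ioi ?_
        rintro r ⟨h0, h2⟩
        have h3 : |R| + 1 ≤ r := by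
          by_contra! h
          exact h2 ⟨le_of_lt h0, h.le⟩
        simp [hF₁, hdz r θ h3]
      · refine tendsto_const_nhds.congr' ?_
        filter_upwards [Filter.eventually_ge_atTop (|R| + 1)] with r hr
        by_contra h
        have h1 := hR _ (subset_tsupport _ (Ne.symm h))
        rw [norm_mul, hen, mul_one, norm_real, Real.norm_eq_abs] at h1
        have := le_abs_self r; have := le_abs_self R
        linarith
    simp_rw [this]
    rw [setIntegral_const, Real.volume_real_Ioo_of_le (by linarith [Real.pi_pos]), real_smul]
    push_cast
    ring
  have e2 : ∫ p in Ioi (0 : ℝ) ×ˢ Ioo (-Real.pi) Real.pi, F₂ p ∂(volume.prod volume) = 0 := by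
    rw [← Measure.prod_restrict, integral_prod _ (by rwa [Measure.prod_restrict])]
    refine setIntegral_eq_zero_of_forall_eq_zero fun r hr => ?_
    have hr : (0 : ℝ) < r := hr
    have hrc : (r : ℂ) ≠ 0 := ofReal_ne_zero.2 hr.ne'
    have hd : ∀ θ : ℝ, HasDerivAt (fun θ : ℝ => I * (r : ℂ)⁻¹ * B (r * e θ)) (F₂ (r, θ)) θ := fun θ => by
      have h1 : HasDerivAt (fun θ : ℝ => (r : ℂ) * e θ) (r * (I * e θ)) θ :=
        (hed θ).const_mul _
      have h2 := ((hB.differentiable one_ne_zero _).hasFDerivAt.comp_hasDerivAt θ h1).const_mul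
        (I * (r : ℂ)⁻¹)
      convert! h2 using 1
      simp only [hF₂]
      have h3 := (fderiv ℝ B (r * e θ)).map_smul r (I * e θ)
      rw [real_smul, real_smul] at h3
      rw [h3]
      field_simp
    rw [← integral_Ioc_eq_integral_Ioo, ← intervalIntegral.integral_of_le (by linarith [Real.pi_pos]),
      intervalIntegral.integral_eq_sub_of_hasDerivAt (fun θ _ => hd θ)]
    · simp [he]
    · exact (by simp only [hF₂]; fun_prop : Continuous fun θ => F₂ (r, θ)).intervalIntegrable _ _
  rw [e1, e2, add_zero]

/-- The inhomogeneous Cauchy-Riemann equation with smooth compactly supported right-hand side has a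
smooth solution. -/
theorem exists_contDiff_dbar_eq {b : ℂ → ℂ} (hb : ContDiff ℝ ∞ b) (hc : HasCompactSupport b) :
    ∃ u : ℂ → ℂ, ContDiff ℝ ∞ u ∧ ∀ z, fderiv ℝ u z 1 + I * fderiv ℝ u z I = b z := by
  set M := ContinuousLinearMap.mul ℝ ℂ
  -- The constant is `1 / (2π)` rather than `1 / π` because the operator here is twice `∂/∂z̄`.
  set k : ℂ → ℂ := fun z => (2 * Real.pi : ℂ)⁻¹ * z⁻¹ with hk
  have hkl : LocallyIntegrable k := by
    simpa [hk, Pi.smul_def] using locallyIntegrable_inv.smul ((2 * Real.pi : ℂ)⁻¹)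
  refine ⟨convolution k b M volume, hc.contDiff_convolution_right M hkl hb, fun z => ?_⟩
  have hb1 : ContDiff ℝ 1 b := hb.of_le (by exact_mod_cast le_top)
  rw [(hc.hasFDerivAt_convolution_right M hkl hb1 z).fderiv,
    convolution_precompR_apply M hkl (hc.fderiv ℝ) (hb1.continuous_fderiv one_ne_zero),
    convolution_precompR_apply M hkl (hc.fderiv ℝ) (hb1.continuous_fderiv one_ne_zero)]
  have hint : ∀ v : ℂ, Integrable (fun t => k t * fderiv ℝ b (z - t) v) := fun v =>
    HasCompactSupport.convolutionExists_right M
      ((hc.fderiv ℝ).comp_left (g := fun D : ℂ →L[ℝ] ℂ => D v) rfl) hkl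
      ((hb1.continuous_fderiv one_ne_zero).clm_apply continuous_const) z
  simp only [convolution, M, ContinuousLinearMap.mul_apply']
  rw [← integral_const_mul, ← integral_add (hint 1) ((hint I).const_mul I)]
  -- The derivatives fall on `b`. Reflecting the variable changes their sign, which cancels the sign
  -- in `integral_inv_mul_dbar`, and the value at `t = 0` is `b z`.
  have hB : ContDiff ℝ 1 (fun t => b (z - t)) := hb1.comp (contDiff_const.sub contDiff_id)
  have hBc : HasCompactSupport (fun t => b (z - t)) :=
    hc.comp_homeomorph (Homeomorph.subLeft z)
  have hfd : ∀ t v, fderiv ℝ (fun t => b (z - t)) t v = - fderiv ℝ b (z - t) v := fun t v => by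
    have h1 : HasFDerivAt (fun t : ℂ => z - t) (-ContinuousLinearMap.id ℝ ℂ) t := by
      simpa using (hasFDerivAt_id t).const_sub z
    have h2 : HasFDerivAt (fun t => b (z - t)) _ t :=
      (hb1.differentiable one_ne_zero _).hasFDerivAt.comp t h1
    rw [h2.fderiv]
    simp
  have h := integral_inv_mul_dbar hB hBc
  simp only [hfd, sub_zero] at h
  have hpi : (Real.pi : ℂ) ≠ 0 := ofReal_ne_zero.2 Real.pi_ne_zero
  have h2 : ∀ t, k t * fderiv ℝ b (z - t) 1 + I * (k t * fderiv ℝ b (z - t) I) =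
      -(2 * Real.pi : ℂ)⁻¹ * (t⁻¹ * (-fderiv ℝ b (z - t) 1 + I * -fderiv ℝ b (z - t) I)) :=
    fun t => by simp only [hk]; ring
  simp_rw [h2]
  rw [integral_const_mul, h]
  field_simp

end Planar

/-! ### Products and quotients of smooth complex functions. -/

section ComplexValued

variable {E : Type*} [NormedAddCommGroup E] [NormedSpace ℝ E] {H : Type*} [TopologicalSpace H]
  {I : ModelWithCorners ℝ E H} {M : Type*} [TopologicalSpace M] [ChartedSpace H M] {n : ℕ∞ω}
  {f g : M → ℂ} {x : M}

theorem ContMDiffAt.mul_complex (hf : ContMDiffAt I 𝓘(ℝ, ℂ) n f x)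
    (hg : ContMDiffAt I 𝓘(ℝ, ℂ) n g x) : ContMDiffAt I 𝓘(ℝ, ℂ) n (fun y => f y * g y) x :=
  (contDiff_mul (𝕜 := ℝ) (𝔸 := ℂ)).contDiffAt.comp_contMDiffAt (hf.prodMk_space hg)

theorem ContMDiffAt.div_complex (hf : ContMDiffAt I 𝓘(ℝ, ℂ) n f x)
    (hg : ContMDiffAt I 𝓘(ℝ, ℂ) n g x) (h0 : g x ≠ 0) :
    ContMDiffAt I 𝓘(ℝ, ℂ) n (fun y => f y / g y) x := by
  simp_rw [div_eq_mul_inv]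
  exact hf.mul_complex ((contDiffAt_inv ℝ h0).comp_contMDiffAt hg)

end ComplexValued

/-! ### Smooth fibre coordinates, their ratios and their trivializations. -/

section FiberCoord

open Set Filter Topology

variable {S : Type u} [TopologicalSpace S] [ChartedSpace ℂ S]
  (L : S → Type v) [∀ x, AddCommGroup (L x)] [∀ x, Module ℂ (L x)]
  [∀ x, TopologicalSpace (L x)] [TopologicalSpace (TotalSpace ℂ L)] [FiberBundle ℂ L]

variable {L} in
/-- A smooth fibre coordinate over an open set `U`: a function on the total space which is smooth
over `U` and restricts to a complex linear isomorphism on each fibre over `U`. -/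
structure IsFiberCoord (φ : TotalSpace ℂ L → ℂ) (U : Set S) : Prop where
  isOpen : IsOpen U
  map_add : ∀ x ∈ U, ∀ y z : L x, φ ⟨x, y + z⟩ = φ ⟨x, y⟩ + φ ⟨x, z⟩
  map_smul : ∀ x ∈ U, ∀ (c : ℂ) (y : L x), φ ⟨x, c • y⟩ = c * φ ⟨x, y⟩
  eq_zero : ∀ x ∈ U, ∀ y : L x, φ ⟨x, y⟩ = 0 → y = 0
  smooth : ContMDiffOn (𝓘(ℝ, ℂ).prod 𝓘(ℝ, ℂ)) 𝓘(ℝ, ℂ) ∞ φ (π ℂ L ⁻¹' U)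

/-- A nonzero vector in the fibre over `x`. -/
noncomputable def unitVec (x : S) : L x := (trivializationAt ℂ L x).symm x 1

variable {L} in
/-- The quotient of two fibre coordinates, as a function on the base. -/
noncomputable def coordRatio (φ ψ : TotalSpace ℂ L → ℂ) (x : S) : ℂ :=
  φ ⟨x, unitVec L x⟩ / ψ ⟨x, unitVec L x⟩

variable {L}

theorem trivializationAt_unitVec (x : S) :
    (trivializationAt ℂ L x ⟨x, unitVec L x⟩).2 = 1 := by
  rw [unitVec, Trivialization.apply_mk_symm _ (FiberBundle.mem_baseSet_trivializationAt' x)]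

/-- `unitVec` uses a different trivialization at each point, so it need not vary smoothly; this
local section replaces it in smoothness proofs. -/
theorem contMDiffAt_trivializationAt_symm_one (x₀ : S) : ContMDiffAt 𝓘(ℝ, ℂ) (𝓘(ℝ, ℂ).prod 𝓘(ℝ, ℂ)) ∞
    (fun x => (⟨x, (trivializationAt ℂ L x₀).symm x 1⟩ : TotalSpace ℂ L)) x₀ := by
  have h0 : x₀ ∈ (trivializationAt ℂ L x₀).baseSet := FiberBundle.mem_baseSet_trivializationAt' x₀
  refine contMDiffAt_totalSpace.2 ⟨contMDiffAt_id, ?_⟩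
  refine (contMDiffAt_const (c := (1 : ℂ))).congr_of_eventuallyEq ?_
  filter_upwards [(trivializationAt ℂ L x₀).open_baseSet.mem_nhds h0] with x hx
  rw [Trivialization.apply_mk_symm _ hx]

theorem IsFiberCoord.contMDiffAt_of_mem {φ : TotalSpace ℂ L → ℂ} {U : Set S} (hφ : IsFiberCoord φ U) {p : TotalSpace ℂ L} (hp : p.proj ∈ U) :
    ContMDiffAt (𝓘(ℝ, ℂ).prod 𝓘(ℝ, ℂ)) 𝓘(ℝ, ℂ) ∞ φ p :=
  hφ.smooth.contMDiffAt ((hφ.isOpen.preimage (FiberBundle.continuous_proj ℂ L)).mem_nhds hp)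

theorem isFiberCoord_trivializationAt [VectorBundle ℂ ℂ L] [ContMDiffVectorBundle ∞ ℂ L 𝓘(ℝ, ℂ)]
    (x₀ : S) : IsFiberCoord (fun p => (trivializationAt ℂ L x₀ p).2)
      (trivializationAt ℂ L x₀).baseSet where
  isOpen := (trivializationAt ℂ L x₀).open_baseSet
  map_add x hx y z := ((trivializationAt ℂ L x₀).linear ℂ hx).map_add y z
  map_smul x hx c y := ((trivializationAt ℂ L x₀).linear ℂ hx).map_smul c y
  eq_zero x hx y h := by
    have h0 : (trivializationAt ℂ L x₀ ⟨x, 0⟩).2 = 0 :=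
      congr_arg Prod.snd ((trivializationAt ℂ L x₀).zeroSection ℂ hx)
    have := congr_arg ((trivializationAt ℂ L x₀).symm x) (h.trans h0.symm)
    simpa [hx] using this
  smooth := by
    intro p hp
    have h := (Trivialization.contMDiffAt_iff (n := ∞) (IM := 𝓘(ℝ, ℂ).prod 𝓘(ℝ, ℂ)) (IB := 𝓘(ℝ, ℂ))
      (e := trivializationAt ℂ L x₀) (f := id) (x₀ := p) (by
        simpa [Trivialization.mem_source] using hp)).1 contMDiffAt_id
    exact h.2.contMDiffWithinAt

section

variable [VectorBundle ℂ ℂ L]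

theorem trivializationAt_symm_one_ne_zero {x₀ x : S} (hx : x ∈ (trivializationAt ℂ L x₀).baseSet) :
    (trivializationAt ℂ L x₀).symm x 1 ≠ 0 := by
  intro h
  have h1 := congr_arg Prod.snd ((trivializationAt ℂ L x₀).apply_mk_symm hx 1)
  have h0 : (trivializationAt ℂ L x₀ ⟨x, 0⟩).2 = 0 := congr_arg Prod.snd
    ((trivializationAt ℂ L x₀).zeroSection ℂ hx)
  rw [h, h0] at h1
  exact zero_ne_one h1

theorem unitVec_ne_zero (x : S) : unitVec L x ≠ 0 := by
  intro h
  have h1 := trivializationAt_unitVec (L := L) x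
  have h0 : (trivializationAt ℂ L x ⟨x, 0⟩).2 = 0 := congr_arg Prod.snd
    ((trivializationAt ℂ L x).zeroSection ℂ (FiberBundle.mem_baseSet_trivializationAt' x))
  rw [h, h0] at h1
  exact zero_ne_one h1

theorem eq_smul_unitVec {x : S} (y : L x) : ∃ c : ℂ, y = c • unitVec L x := by
  have hx : x ∈ (trivializationAt ℂ L x).baseSet := FiberBundle.mem_baseSet_trivializationAt' x
  refine ⟨(trivializationAt ℂ L x ⟨x, y⟩).2, ?_⟩
  have h1 : (trivializationAt ℂ L x ⟨x, (trivializationAt ℂ L x ⟨x, y⟩).2 • unitVec L x⟩).2 =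
      (trivializationAt ℂ L x ⟨x, y⟩).2 := by
    rw [((trivializationAt ℂ L x).linear ℂ hx).map_smul, trivializationAt_unitVec, smul_eq_mul,
      mul_one]
  have := congr_arg ((trivializationAt ℂ L x).symm x) h1
  simpa [hx] using this.symm

namespace IsFiberCoord

variable {φ ψ χ : TotalSpace ℂ L → ℂ} {U V W : Set S}

theorem apply_unitVec_ne_zero (hφ : IsFiberCoord φ U) {x : S} (hx : x ∈ U) :
    φ ⟨x, unitVec L x⟩ ≠ 0 := fun h => unitVec_ne_zero x (hφ.eq_zero x hx _ h)

theorem eq_coordRatio_mul (hφ : IsFiberCoord φ U) (hψ : IsFiberCoord ψ V) {x : S} (hx : x ∈ U)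
    (hx' : x ∈ V) (y : L x) : φ ⟨x, y⟩ = coordRatio φ ψ x * ψ ⟨x, y⟩ := by
  obtain ⟨c, rfl⟩ := eq_smul_unitVec y
  have := hψ.apply_unitVec_ne_zero hx'
  rw [hφ.map_smul x hx, hψ.map_smul x hx', coordRatio]
  field_simp

theorem coordRatio_ne_zero (hφ : IsFiberCoord φ U) (hψ : IsFiberCoord ψ V) {x : S} (hx : x ∈ U)
    (hx' : x ∈ V) : coordRatio φ ψ x ≠ 0 :=
  div_ne_zero (hφ.apply_unitVec_ne_zero hx) (hψ.apply_unitVec_ne_zero hx')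

/-- Fibres are one-dimensional, so any nonzero vector computes the ratio, in particular the value of
a smooth local section. -/
theorem coordRatio_eq_of_ne_zero (hφ : IsFiberCoord φ U) (hψ : IsFiberCoord ψ V) {x : S}
    (hx : x ∈ U) (hx' : x ∈ V) {y : L x} (hy : y ≠ 0) :
    coordRatio φ ψ x = φ ⟨x, y⟩ / ψ ⟨x, y⟩ := by
  rw [hφ.eq_coordRatio_mul hψ hx hx', mul_div_cancel_right₀]
  exact fun h => hy (hψ.eq_zero x hx' y h)

theorem coordRatio_mul_coordRatio (hψ : IsFiberCoord ψ V) (φ χ : TotalSpace ℂ L → ℂ) {x : S}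
    (hx : x ∈ V) : coordRatio φ ψ x * coordRatio ψ χ x = coordRatio φ χ x :=
  div_mul_div_cancel₀ (hψ.apply_unitVec_ne_zero hx)

theorem coordRatio_mul_comp_proj (hφ : IsFiberCoord φ U) (f : S → ℂ) {x : S} (hx : x ∈ U) :
    coordRatio (fun p : TotalSpace ℂ L => f p.proj * φ p) φ x = f x :=
  mul_div_cancel_right₀ _ (hφ.apply_unitVec_ne_zero hx)

variable [ContMDiffVectorBundle ∞ ℂ L 𝓘(ℝ, ℂ)]

theorem contMDiffAt_coordRatio (hφ : IsFiberCoord φ U) (hψ : IsFiberCoord ψ V) {x : S} (hx : x ∈ U)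
    (hx' : x ∈ V) : ContMDiffAt 𝓘(ℝ, ℂ) 𝓘(ℝ, ℂ) ∞ (coordRatio φ ψ) x := by
  have h0 : x ∈ (trivializationAt ℂ L x).baseSet := FiberBundle.mem_baseSet_trivializationAt' x
  have hs := contMDiffAt_trivializationAt_symm_one (L := L) x
  have h1 := (hφ.contMDiffAt_of_mem (p := ⟨x, (trivializationAt ℂ L x).symm x 1⟩) hx).comp x hs
  have h2 := (hψ.contMDiffAt_of_mem (p := ⟨x, (trivializationAt ℂ L x).symm x 1⟩) hx').comp x hs
  refine (h1.div_complex h2 fun h => trivializationAt_symm_one_ne_zero h0 (hψ.eq_zero x hx' _ h)).congr_of_eventuallyEq ?_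
  filter_upwards [(trivializationAt ℂ L x).open_baseSet.mem_nhds h0, hφ.isOpen.mem_nhds hx,
    hψ.isOpen.mem_nhds hx'] with z hz hzU hzV
  exact hφ.coordRatio_eq_of_ne_zero hψ hzU hzV (trivializationAt_symm_one_ne_zero hz)

/-- The rescaled vector is the one with `φ`-coordinate `q.2`, whatever the choice of `unitVec`. In a
bundle trivialization its coordinate is a smooth ratio times `q.2`. -/
theorem contMDiffAt_inv (hφ : IsFiberCoord φ U) {q : S × ℂ} (hq : q.1 ∈ U) :
    ContMDiffAt (𝓘(ℝ, ℂ).prod 𝓘(ℝ, ℂ)) (𝓘(ℝ, ℂ).prod 𝓘(ℝ, ℂ)) ∞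
      (fun q : S × ℂ => (⟨q.1, (q.2 / φ ⟨q.1, unitVec L q.1⟩) • unitVec L q.1⟩ : TotalSpace ℂ L))
      q := by
  have h0 : q.1 ∈ (trivializationAt ℂ L q.1).baseSet :=
    FiberBundle.mem_baseSet_trivializationAt' q.1
  have hφ₁ := isFiberCoord_trivializationAt (L := L) q.1
  have hr := (hφ₁.contMDiffAt_coordRatio hφ h0 hq).comp q
    (contMDiffAt_fst (I := 𝓘(ℝ, ℂ)) (J := 𝓘(ℝ, ℂ)))
  refine contMDiffAt_totalSpace.2 ⟨contMDiffAt_fst, ?_⟩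
  refine (hr.mul_complex contMDiffAt_snd).congr_of_eventuallyEq ?_
  filter_upwards [continuous_fst.continuousAt.preimage_mem_nhds
    (hφ₁.isOpen.mem_nhds h0)] with z hz
  change (trivializationAt ℂ L q.1 _).2 = coordRatio _ _ z.1 * z.2
  rw [hφ₁.map_smul _ hz, coordRatio]
  ring

/-- The local trivialization given by a fibre coordinate. -/
noncomputable def toTrivialization (hφ : IsFiberCoord φ U) : Trivialization ℂ (π ℂ L) where
  toFun p := (p.proj, φ p)
  invFun q := ⟨q.1, (q.2 / φ ⟨q.1, unitVec L q.1⟩) • unitVec L q.1⟩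
  source := π ℂ L ⁻¹' U
  target := U ×ˢ univ
  baseSet := U
  map_source' p hp := ⟨hp, mem_univ _⟩
  map_target' q hq := hq.1
  left_inv' := by
    rintro ⟨x, y⟩ hx
    obtain ⟨c, rfl⟩ := eq_smul_unitVec y
    change x ∈ U at hx
    dsimp only
    rw [hφ.map_smul x hx, mul_div_cancel_right₀ _ (hφ.apply_unitVec_ne_zero hx)]
  right_inv' := by
    rintro ⟨x, c⟩ ⟨hx, -⟩
    dsimp only at hx ⊢
    rw [hφ.map_smul x hx, div_mul_cancel₀ _ (hφ.apply_unitVec_ne_zero hx)]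
  open_source := hφ.isOpen.preimage (FiberBundle.continuous_proj ℂ L)
  open_target := hφ.isOpen.prod isOpen_univ
  open_baseSet := hφ.isOpen
  source_eq := rfl
  target_eq := rfl
  proj_toFun _ _ := rfl
  continuousOn_toFun :=
    (FiberBundle.continuous_proj ℂ L).continuousOn.prodMk hφ.smooth.continuousOn
  continuousOn_invFun := fun _ hq => (hφ.contMDiffAt_inv hq.1).continuousAt.continuousWithinAt

theorem contMDiffOn_toTrivialization (hφ : IsFiberCoord φ U) :
    ContMDiffOn (𝓘(ℝ, ℂ).prod 𝓘(ℝ, ℂ)) (𝓘(ℝ, ℂ).prod 𝓘(ℝ, ℂ)) ∞ hφ.toTrivialization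
      hφ.toTrivialization.source :=
  (contMDiffOn_proj L).prodMk hφ.smooth

theorem contMDiffOn_toTrivialization_symm (hφ : IsFiberCoord φ U) :
    ContMDiffOn (𝓘(ℝ, ℂ).prod 𝓘(ℝ, ℂ)) (𝓘(ℝ, ℂ).prod 𝓘(ℝ, ℂ)) ∞
      hφ.toTrivialization.toOpenPartialHomeomorph.symm hφ.toTrivialization.target :=
  fun _ hq => (hφ.contMDiffAt_inv hq.1).contMDiffWithinAt

theorem isLinear_toTrivialization (hφ : IsFiberCoord φ U) : hφ.toTrivialization.IsLinear ℂ where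
  linear x hx := { map_add := hφ.map_add x hx, map_smul := hφ.map_smul x hx }

/-- Change of gauge, to be applied with `f` an exponential. -/
theorem mul_comp_proj (hφ : IsFiberCoord φ U) {f : S → ℂ} (hV : IsOpen V) (hVU : V ⊆ U)
    (hf : ContMDiffOn 𝓘(ℝ, ℂ) 𝓘(ℝ, ℂ) ∞ f V) (hf0 : ∀ x ∈ V, f x ≠ 0) :
    IsFiberCoord (fun p => f p.proj * φ p) V where
  isOpen := hV
  map_add x hx y z := by rw [hφ.map_add x (hVU hx), mul_add]
  map_smul x hx c y := by rw [hφ.map_smul x (hVU hx)]; ring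
  eq_zero x hx y h := hφ.eq_zero x (hVU hx) y ((mul_eq_zero.1 h).resolve_left (hf0 x hx))
  smooth := fun p hp =>
    (((hf p.proj hp).contMDiffAt (hV.mem_nhds hp)).comp p (contMDiffAt_proj L)).mul_complex
      (hφ.contMDiffAt_of_mem (hVU hp)) |>.contMDiffWithinAt

end IsFiberCoord

end

end FiberCoord

/-! ### The operator `dbar` on complex curves. -/

section Dbar

open Complex Set Filter Topology

variable {M : Type*} [TopologicalSpace M] [ChartedSpace ℂ M]
  {M' : Type*} [TopologicalSpace M'] [ChartedSpace ℂ M']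

theorem isManifold_real_of_complex (M : Type*) [TopologicalSpace M] [ChartedSpace ℂ M]
    [IsManifold 𝓘(ℂ, ℂ) ω M] : IsManifold 𝓘(ℝ, ℂ) ∞ M := by
  refine isManifold_of_contDiffOn _ _ _ fun e e' he he' => ?_
  have h := (contDiffGroupoid ω 𝓘(ℂ, ℂ)).compatible he he'
  rw [contDiffGroupoid, mem_groupoid_of_pregroupoid] at h
  exact ((show ContDiffOn ℂ ω _ _ from h.1).restrict_scalars ℝ).of_le le_top

/-- The real differential of a complex valued function on a complex curve. -/
noncomputable def realDeriv (F : M → ℂ) (x : M) : ℂ →L[ℝ] ℂ := mfderiv 𝓘(ℝ, ℂ) 𝓘(ℝ, ℂ) F x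

/-- Twice the conjugate-linear part of the real differential of `F` at `x`. -/
noncomputable def dbar (F : M → ℂ) (x : M) (v : ℂ) : ℂ :=
  realDeriv F x v + I * realDeriv F x (I * v)

/-- The logarithmic version of `dbar`. -/
noncomputable def dbarLog (F : M → ℂ) (x : M) (v : ℂ) : ℂ := dbar F x v / F x

theorem realDeriv_eq {F : M → ℂ} {x : M} {D : ℂ →L[ℝ] ℂ}
    (h : HasMFDerivAt 𝓘(ℝ, ℂ) 𝓘(ℝ, ℂ) F x D) : realDeriv F x = D := h.mfderiv

theorem hasMFDerivAt_realDeriv {F : M → ℂ} {x : M}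
    (h : MDifferentiableAt 𝓘(ℝ, ℂ) 𝓘(ℝ, ℂ) F x) :
    HasMFDerivAt 𝓘(ℝ, ℂ) 𝓘(ℝ, ℂ) F x (realDeriv F x) := h.hasMFDerivAt

theorem dbar_eq_conj_mul (F : M → ℂ) (x : M) (v : ℂ) : dbar F x v = conj v * dbar F x 1 := by
  simp only [dbar, mul_one]
  exact apply_add_I_mul_apply_I_mul _ v

theorem dbar_congr {F F' : M → ℂ} {x : M} (h : F =ᶠ[𝓝 x] F') (v : ℂ) : dbar F x v = dbar F' x v := by
  have : realDeriv F x = realDeriv F' x := h.mfderiv_eq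
  simp only [dbar, this]

theorem dbarLog_congr {F F' : M → ℂ} {x : M} (h : F =ᶠ[𝓝 x] F') (v : ℂ) :
    dbarLog F x v = dbarLog F' x v := by
  rw [dbarLog, dbarLog, dbar_congr h, h.eq_of_nhds]

theorem dbarLog_mul {F F' : M → ℂ} {x : M} (hF : MDifferentiableAt 𝓘(ℝ, ℂ) 𝓘(ℝ, ℂ) F x)
    (hF' : MDifferentiableAt 𝓘(ℝ, ℂ) 𝓘(ℝ, ℂ) F' x) (h0 : F x ≠ 0) (h0' : F' x ≠ 0) (v : ℂ) :
    dbarLog (fun y => F y * F' y) x v = dbarLog F x v + dbarLog F' x v := by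
  have h := realDeriv_eq ((hasMFDerivAt_realDeriv hF).mul (hasMFDerivAt_realDeriv hF'))
  have h2 : realDeriv (fun y => F y * F' y) x = _ := h
  simp only [dbarLog, dbar, h2]
  change (F x * realDeriv F' x v + F' x * realDeriv F x v + I * (F x * realDeriv F' x (I * v) +
    F' x * realDeriv F x (I * v))) / _ = _
  field_simp
  ring

theorem dbarLog_exp {F : M → ℂ} {x : M} (hF : MDifferentiableAt 𝓘(ℝ, ℂ) 𝓘(ℝ, ℂ) F x) (v : ℂ) :
    dbarLog (fun y => exp (F y)) x v = dbar F x v := by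
  have h1 : HasMFDerivAt 𝓘(ℝ, ℂ) 𝓘(ℝ, ℂ) exp (F x)
      ((ContinuousLinearMap.toSpanSingleton ℂ (exp (F x))).restrictScalars ℝ) :=
    ((Complex.hasDerivAt_exp (F x)).hasFDerivAt.restrictScalars ℝ).hasMFDerivAt
  have h2 : realDeriv (fun y => exp (F y)) x = _ :=
    realDeriv_eq (h1.comp x (hasMFDerivAt_realDeriv hF))
  simp only [dbarLog, dbar, h2]
  change (realDeriv F x v * exp (F x) + I * (realDeriv F x (I * v) * exp (F x))) / _ = _
  have := exp_ne_zero (F x)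
  field_simp

theorem dbar_comp {F : M' → ℂ} {g : M → M'} {x : M} {D : ℂ →L[ℝ] ℂ}
    (hF : MDifferentiableAt 𝓘(ℝ, ℂ) 𝓘(ℝ, ℂ) F (g x))
    (hg : HasMFDerivAt 𝓘(ℝ, ℂ) 𝓘(ℝ, ℂ) g x D) (hD : ∀ c v : ℂ, D (c * v) = c * D v) (v : ℂ) :
    dbar (fun y => F (g y)) x v = dbar F (g x) (D v) := by
  have h2 : realDeriv (fun y => F (g y)) x = _ :=
    realDeriv_eq ((hasMFDerivAt_realDeriv hF).comp x hg)
  simp only [dbar, h2]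
  change realDeriv F (g x) (D v) + I * realDeriv F (g x) (D (I * v)) = _
  rw [hD]

/-- The conjugate-linear `D` reverses the sign of `I`, and the outer conjugation reverses it back.
-/
theorem dbar_conj_comp {F : M' → ℂ} {g : M → M'} {x : M} {D : ℂ →L[ℝ] ℂ}
    (hF : MDifferentiableAt 𝓘(ℝ, ℂ) 𝓘(ℝ, ℂ) F (g x))
    (hg : HasMFDerivAt 𝓘(ℝ, ℂ) 𝓘(ℝ, ℂ) g x D) (hD : ∀ c v : ℂ, D (c * v) = conj c * D v) (v : ℂ) :
    dbar (fun y => conj (F (g y))) x v = conj (dbar F (g x) (D v)) := by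
  have h1 : HasMFDerivAt 𝓘(ℝ, ℂ) 𝓘(ℝ, ℂ) (conj : ℂ → ℂ) (F (g x))
      (conjCLE : ℂ →L[ℝ] ℂ) := conjCLE.hasFDerivAt.hasMFDerivAt
  have h2 : realDeriv (fun y => conj (F (g y))) x = _ :=
    realDeriv_eq (h1.comp x ((hasMFDerivAt_realDeriv hF).comp x hg))
  simp only [dbar, h2]
  change conj (realDeriv F (g x) (D v)) + I * conj (realDeriv F (g x) (D (I * v))) = _
  rw [hD]
  simp [map_neg]

/-- The vanishing is the Cauchy-Riemann equation `dF(I) = I · dF(1)`, which makes the real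
differential complex linear. -/
theorem mdifferentiableAt_complex_of_dbar_eq_zero {F : M → ℂ} {x : M}
    (hF : MDifferentiableAt 𝓘(ℝ, ℂ) 𝓘(ℝ, ℂ) F x) (h : dbar F x 1 = 0) :
    MDifferentiableAt 𝓘(ℂ, ℂ) 𝓘(ℂ, ℂ) F x := by
  have hD := hasMFDerivAt_realDeriv hF
  have hI : realDeriv F x I = I * realDeriv F x 1 := by
    simp only [dbar, mul_one] at h
    linear_combination (-I) * h + realDeriv F x I * I_sq
  have hlin : ((ContinuousLinearMap.toSpanSingleton ℂ (realDeriv F x 1)).restrictScalars ℝ) =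
      realDeriv F x := by
    ext z
    have hz := congr_arg (realDeriv F x) (show z = z.re • (1 : ℂ) + z.im • I by simp [re_add_im])
    rw [map_add, map_smul, map_smul, hI, real_smul, real_smul] at hz
    rw [hz]
    change z * realDeriv F x 1 = _
    linear_combination (-(realDeriv F x 1)) * re_add_im z
  refine (show HasMFDerivAt 𝓘(ℂ, ℂ) 𝓘(ℂ, ℂ) F x
    (ContinuousLinearMap.toSpanSingleton ℂ (realDeriv F x 1)) from
      ⟨hD.1, ?_⟩).mdifferentiableAt
  exact HasFDerivWithinAt.of_restrictScalars ℝ hD.2 hlin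

theorem HasMFDerivAt.restrictScalars_real {g : M → M'} {x : M} {D : ℂ →L[ℂ] ℂ}
    (h : HasMFDerivAt 𝓘(ℂ, ℂ) 𝓘(ℂ, ℂ) g x D) :
    HasMFDerivAt 𝓘(ℝ, ℂ) 𝓘(ℝ, ℂ) g x (D.restrictScalars ℝ) :=
  ⟨h.1, h.2.restrictScalars ℝ⟩

theorem MAntiholomorphic.exists_hasMFDerivAt {g : M → M'}
    (h : MAntiholomorphic 𝓘(ℂ, ℂ) 𝓘(ℂ, ℂ) g) (x : M) : ∃ D : ℂ →L[ℝ] ℂ,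
      HasMFDerivAt 𝓘(ℝ, ℂ) 𝓘(ℝ, ℂ) g x D ∧ ∀ c v : ℂ, D (c * v) = conj c * D v := by
  obtain ⟨hc, D, hD, h⟩ := h x
  exact ⟨D, ⟨hc, h⟩, hD⟩

theorem MDifferentiableAt.exists_hasMFDerivAt_real {g : M → M'} {x : M}
    (h : MDifferentiableAt 𝓘(ℂ, ℂ) 𝓘(ℂ, ℂ) g x) : ∃ D : ℂ →L[ℝ] ℂ,
      HasMFDerivAt 𝓘(ℝ, ℂ) 𝓘(ℝ, ℂ) g x D ∧ ∀ c v : ℂ, D (c * v) = c * D v := by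
  have := h.hasMFDerivAt
  exact ⟨_, HasMFDerivAt.restrictScalars_real this, fun c v =>
    (mfderiv 𝓘(ℂ, ℂ) 𝓘(ℂ, ℂ) g x).map_smul c v⟩

/-- The operator `dbar` is computed in the chart at `x₀`, up to a factor not depending on the
function. -/
theorem exists_dbar_eq_mul_chart [IsManifold 𝓘(ℂ, ℂ) ω M] (x₀ : M) {x : M}
    (hx : x ∈ (chartAt ℂ x₀).source) : ∃ κ : ℂ → ℂ, ∀ F : M → ℂ,
      MDifferentiableAt 𝓘(ℝ, ℂ) 𝓘(ℝ, ℂ) F x → ∀ v,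
      dbar F x v = κ v * dbar (F ∘ (chartAt ℂ x₀).symm) (chartAt ℂ x₀ x) 1 := by
  have : IsManifold 𝓘(ℂ, ℂ) 1 M := IsManifold.of_le (n := ω) le_top
  have : IsManifold 𝓘(ℝ, ℂ) ∞ M := isManifold_real_of_complex M
  have : IsManifold 𝓘(ℝ, ℂ) 1 M := IsManifold.of_le (n := ∞) (by exact_mod_cast le_top)
  obtain ⟨D, hD, hDl⟩ := (mdifferentiableAt_atlas (I := 𝓘(ℂ, ℂ))
    (chart_mem_atlas ℂ x₀) hx).exists_hasMFDerivAt_real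
  -- `D` is the differential of the chart; pulling back along it evaluates the conjugate-linear form
  -- at `D v`, which gives the factor `conj (D v)`.
  refine ⟨fun v => conj (D v), fun F hF v => ?_⟩
  change _ = conj (D v) * _
  rw [← dbar_eq_conj_mul]
  have hs := mdifferentiableAt_atlas_symm (I := 𝓘(ℝ, ℂ)) (chart_mem_atlas ℂ x₀)
    ((chartAt ℂ x₀).map_source hx)
  have hF' : MDifferentiableAt 𝓘(ℝ, ℂ) 𝓘(ℝ, ℂ) (F ∘ (chartAt ℂ x₀).symm) (chartAt ℂ x₀ x) :=
    MDifferentiableAt.comp _ (by rwa [(chartAt ℂ x₀).left_inv hx]) hs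
  refine Eq.trans (dbar_congr ?_ v) (dbar_comp hF' hD hDl v)
  filter_upwards [(chartAt ℂ x₀).open_source.mem_nhds hx] with y hy
  simp [(chartAt ℂ x₀).left_inv hy]

theorem dbar_complex (F : ℂ → ℂ) (z : ℂ) : dbar F z 1 = fderiv ℝ F z 1 + I * fderiv ℝ F z I := by
  simp [dbar, realDeriv, mfderiv_eq_fderiv]

end Dbar

/-! ### The averaged `∂̄`-operator and its flat coordinates. -/

section Connection

open Complex Set Filter Topology

variable {S : Type u} [TopologicalSpace S] [ChartedSpace ℂ S]
  {L : S → Type v} [∀ x, AddCommGroup (L x)] [∀ x, Module ℂ (L x)]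
  [∀ x, TopologicalSpace (L x)] [TopologicalSpace (TotalSpace ℂ L)] [FiberBundle ℂ L]
  {J : Type*} [Fintype J]

/-- A finite family of smooth fibre coordinates with a subordinate smooth partition of unity. -/
structure IsCoordCover (ρ : J → S → ℝ) (ψ : J → TotalSpace ℂ L → ℂ) (W : J → Set S) : Prop where
  coord : ∀ j, IsFiberCoord (ψ j) (W j)
  smooth : ∀ j, ContMDiff 𝓘(ℝ, ℂ) 𝓘(ℝ, ℝ) ∞ (ρ j)
  support : ∀ j, tsupport (ρ j) ⊆ W j
  sum_eq_one : ∀ x, ∑ j, ρ j x = 1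

/-- The connection form, in the fibre coordinate `φ`, of the `∂̄`-operator obtained by averaging the
trivial operators of the coordinates `ψ j` with weights `ρ j`. -/
noncomputable def connForm (ρ : J → S → ℝ) (ψ : J → TotalSpace ℂ L → ℂ) (φ : TotalSpace ℂ L → ℂ)
    (x : S) (v : ℂ) : ℂ :=
  ∑ j, (ρ j x : ℂ) * dbarLog (coordRatio φ (ψ j)) x v

variable [VectorBundle ℂ ℂ L] [ContMDiffVectorBundle ∞ ℂ L 𝓘(ℝ, ℂ)]
  {ρ : J → S → ℝ} {ψ : J → TotalSpace ℂ L → ℂ} {W : J → Set S}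
  {φ φ' : TotalSpace ℂ L → ℂ} {U U' : Set S}

theorem IsFiberCoord.mdifferentiableAt_coordRatio (hφ : IsFiberCoord φ U)
    (hφ' : IsFiberCoord φ' U') {x : S} (hx : x ∈ U) (hx' : x ∈ U') :
    MDifferentiableAt 𝓘(ℝ, ℂ) 𝓘(ℝ, ℂ) (coordRatio φ φ') x :=
  (hφ.contMDiffAt_coordRatio hφ' hx hx').mdifferentiableAt (by simp)

namespace IsCoordCover

theorem mem_of_ne_zero (h : IsCoordCover ρ ψ W) {j : J} {x : S} (hx : ρ j x ≠ 0) : x ∈ W j :=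
  h.support j (subset_tsupport _ hx)

/-- The gauge transformation rule: near `x` one has `φ' / ψ j = (φ' / φ) · (φ / ψ j)`, `dbarLog`
turns products into sums, and the weights add up to one. -/
theorem connForm_eq_add (h : IsCoordCover ρ ψ W) (hφ : IsFiberCoord φ U)
    (hφ' : IsFiberCoord φ' U') {x : S} (hx : x ∈ U) (hx' : x ∈ U') (v : ℂ) :
    connForm ρ ψ φ' x v = dbarLog (coordRatio φ' φ) x v + connForm ρ ψ φ x v := by
  have h1 : dbarLog (coordRatio φ' φ) x v = ∑ j, (ρ j x : ℂ) * dbarLog (coordRatio φ' φ) x v := by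
    rw [← Finset.sum_mul, ← ofReal_sum, h.sum_eq_one, ofReal_one, one_mul]
  rw [h1, connForm, connForm, ← Finset.sum_add_distrib]
  refine Finset.sum_congr rfl fun j _ => ?_
  -- Where the weight vanishes, `x` may lie outside `W j` and the ratio with `ψ j` carries no
  -- information.
  by_cases hj : ρ j x = 0
  · simp [hj]
  have hxj := h.mem_of_ne_zero hj
  rw [← mul_add, ← dbarLog_mul (hφ'.mdifferentiableAt_coordRatio hφ hx' hx)
    (hφ.mdifferentiableAt_coordRatio (h.coord j) hx hxj) (hφ'.coordRatio_ne_zero hφ hx' hx)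
    (hφ.coordRatio_ne_zero (h.coord j) hx hxj)]
  congr 1
  refine dbarLog_congr ?_ v
  filter_upwards [hφ.isOpen.mem_nhds hx] with y hy
  rw [hφ.coordRatio_mul_coordRatio φ' (ψ j) hy]

/-- Two fibre coordinates which are flat for the `∂̄`-operator differ by a holomorphic factor. -/
theorem mdifferentiableAt_coordRatio_of_flat (h : IsCoordCover ρ ψ W) (hφ : IsFiberCoord φ U)
    (hφ' : IsFiberCoord φ' U') {x : S} (hx : x ∈ U) (hx' : x ∈ U')
    (hf : connForm ρ ψ φ x 1 = 0) (hf' : connForm ρ ψ φ' x 1 = 0) :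
    MDifferentiableAt 𝓘(ℂ, ℂ) 𝓘(ℂ, ℂ) (coordRatio φ' φ) x := by
  refine mdifferentiableAt_complex_of_dbar_eq_zero
    (hφ'.mdifferentiableAt_coordRatio hφ hx' hx) ?_
  have h1 := h.connForm_eq_add hφ hφ' hx hx' 1
  rw [hf, hf', add_zero, dbarLog, eq_comm, div_eq_zero_iff] at h1
  exact h1.resolve_right (hφ'.coordRatio_ne_zero hφ hx' hx)

/-- The connection form in the chart at `x₀`. -/
noncomputable def chartConnForm (ρ : J → S → ℝ) (ψ : J → TotalSpace ℂ L → ℂ)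
    (φ : TotalSpace ℂ L → ℂ) (x₀ : S) (z : ℂ) : ℂ :=
  ∑ j, (ρ j ((chartAt ℂ x₀).symm z) : ℂ) *
    dbarLog (coordRatio φ (ψ j) ∘ (chartAt ℂ x₀).symm) z 1

variable [IsManifold 𝓘(ℂ, ℂ) ω S]

/-- Inside `W j` the ratio is smooth and nonzero; outside it the closed support of `ρ j` is avoided,
so that the term vanishes nearby. -/
theorem contDiffAt_chartConnForm (h : IsCoordCover ρ ψ W) (hφ : IsFiberCoord φ U) (x₀ : S) {z : ℂ}
    (hz : z ∈ (chartAt ℂ x₀).target) (hzU : (chartAt ℂ x₀).symm z ∈ U) :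
    ContDiffAt ℝ ∞ (chartConnForm ρ ψ φ x₀) z := by
  have : IsManifold 𝓘(ℝ, ℂ) ∞ S := isManifold_real_of_complex S
  have hs : ContMDiffAt 𝓘(ℝ, ℂ) 𝓘(ℝ, ℂ) ∞ (chartAt ℂ x₀).symm z :=
    (contMDiffOn_chart_symm (I := 𝓘(ℝ, ℂ)) (n := ∞) (x := x₀)).contMDiffAt
      ((chartAt ℂ x₀).open_target.mem_nhds hz)
  refine ContDiffAt.sum fun j _ => ?_
  by_cases hj : (chartAt ℂ x₀).symm z ∈ W j
  · have hG : ContDiffAt ℝ ∞ (coordRatio φ (ψ j) ∘ (chartAt ℂ x₀).symm) z :=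
      contMDiffAt_iff_contDiffAt.1
        ((hφ.contMDiffAt_coordRatio (h.coord j) hzU hj).comp z hs)
    have hρ : ContDiffAt ℝ ∞ (fun w => ρ j ((chartAt ℂ x₀).symm w)) z :=
      contMDiffAt_iff_contDiffAt.1 ((h.smooth j _).comp z hs)
    have hG' := hG.fderiv_right (m := ∞) (by simp)
    refine (ofRealCLM.contDiff.contDiffAt.comp z hρ).mul ?_
    have heq : (fun w => dbarLog (coordRatio φ (ψ j) ∘ (chartAt ℂ x₀).symm) w 1) = fun w =>
        (fderiv ℝ (coordRatio φ (ψ j) ∘ (chartAt ℂ x₀).symm) w 1 +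
          I * fderiv ℝ (coordRatio φ (ψ j) ∘ (chartAt ℂ x₀).symm) w I) *
          ((coordRatio φ (ψ j) ∘ (chartAt ℂ x₀).symm) w)⁻¹ := by
      ext w
      rw [dbarLog, dbar_complex, div_eq_mul_inv]
    rw [heq]
    exact ((hG'.clm_apply contDiffAt_const).add (contDiffAt_const.mul
      (hG'.clm_apply contDiffAt_const))).mul (hG.inv (hφ.coordRatio_ne_zero (h.coord j) hzU hj))
  · have hj' : (chartAt ℂ x₀).symm z ∈ (tsupport (ρ j))ᶜ := fun h' => hj (h.support j h')
    refine (contDiffAt_const (c := (0 : ℂ))).congr_of_eventuallyEq ?_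
    filter_upwards [hs.continuousAt.preimage_mem_nhds
      ((isClosed_tsupport (ρ j)).isOpen_compl.mem_nhds hj')] with w hw
    have : ρ j ((chartAt ℂ x₀).symm w) = 0 := image_eq_zero_of_notMem_tsupport hw
    simp [this]

/-- Flat fibre coordinates exist locally. -/
theorem exists_flat (h : IsCoordCover ρ ψ W) (x₀ : S) : ∃ (φ : TotalSpace ℂ L → ℂ) (U : Set S),
    x₀ ∈ U ∧ IsFiberCoord φ U ∧ ∀ x ∈ U, ∀ v, connForm ρ ψ φ x v = 0 := by
  have : IsManifold 𝓘(ℝ, ℂ) ∞ S := isManifold_real_of_complex S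
  have hφ := isFiberCoord_trivializationAt (L := L) x₀
  set φ : TotalSpace ℂ L → ℂ := fun p => (trivializationAt ℂ L x₀ p).2
  set U := (trivializationAt ℂ L x₀).baseSet
  have hx₀ : x₀ ∈ U := FiberBundle.mem_baseSet_trivializationAt' x₀
  set c := chartAt ℂ x₀
  have hxc : x₀ ∈ c.source := mem_chart_source ℂ x₀
  set N : Set ℂ := c.target ∩ c.symm ⁻¹' U
  have hN : IsOpen N := c.isOpen_inter_preimage_symm hφ.isOpen
  have hzN : c x₀ ∈ N := ⟨c.map_source hxc, by simpa [c.left_inv hxc] using hx₀⟩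
  obtain ⟨R, hR, hRN⟩ := Metric.nhds_basis_closedBall.mem_iff.1 (hN.mem_nhds hzN)
  -- The bump is `1` on the ball of radius `R / 2` and supported in the closed `R`-ball inside `N`,
  -- so `f · a` extends smoothly by zero to the plane.
  let f : ContDiffBump (c x₀) := ⟨R / 2, R, half_pos hR, half_lt_self hR⟩
  set a := chartConnForm ρ ψ φ x₀
  have hb : ContDiff ℝ ∞ (fun z => -(f z : ℂ) * a z) := by
    refine contDiff_iff_contDiffAt.2 fun z => ?_
    by_cases hz : z ∈ N
    · exact (ofRealCLM.contDiff.contDiffAt.comp z f.contDiffAt).neg.mul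
        (h.contDiffAt_chartConnForm hφ x₀ hz.1 hz.2)
    · have hz' : z ∈ (tsupport f)ᶜ := fun h' => hz (hRN (by rwa [f.tsupport_eq] at h'))
      refine (contDiffAt_const (c := (0 : ℂ))).congr_of_eventuallyEq ?_
      filter_upwards [(isClosed_tsupport f).isOpen_compl.mem_nhds hz'] with w hw
      simp [image_eq_zero_of_notMem_tsupport hw]
  have hc : HasCompactSupport (fun z => -(f z : ℂ) * a z) := by
    refine f.hasCompactSupport.mono fun z hz => ?_
    contrapose! hz
    simp only [Function.mem_support, not_not] at hz ⊢
    simp [hz]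
  -- In the gauge `exp u · φ` the form becomes `dbar u + a` in the chart, hence the minus sign on
  -- the right-hand side. It vanishes where `f = 1`, which dictates `V`.
  obtain ⟨u, hu, hub⟩ := exists_contDiff_dbar_eq hb hc
  set V : Set S := U ∩ (c.source ∩ c ⁻¹' Metric.ball (c x₀) (R / 2))
  have hV : IsOpen V := hφ.isOpen.inter (c.isOpen_inter_preimage Metric.isOpen_ball)
  have hus : ∀ x ∈ V, ContMDiffAt 𝓘(ℝ, ℂ) 𝓘(ℝ, ℂ) ∞ (fun y => u (c y)) x := fun x hx =>
    hu.contDiffAt.contMDiffAt.comp x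
      ((contMDiffOn_chart (I := 𝓘(ℝ, ℂ)) (n := ∞) (x := x₀)).contMDiffAt
        (c.open_source.mem_nhds hx.2.1))
  have hexp : ContMDiffOn 𝓘(ℝ, ℂ) 𝓘(ℝ, ℂ) ∞ (fun y => exp (u (c y))) V := fun x hx =>
    ((contDiff_exp (𝕜 := ℝ)).contDiffAt.comp_contMDiffAt (hus x hx)).contMDiffWithinAt
  have hφ' := hφ.mul_comp_proj hV inter_subset_left hexp fun x _ => exp_ne_zero _
  refine ⟨_, V, ⟨hx₀, hxc, Metric.mem_ball_self (half_pos hR)⟩, hφ', fun x hx v => ?_⟩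
  have hratio : coordRatio (fun p : TotalSpace ℂ L => exp (u (c p.proj)) * φ p) φ =ᶠ[𝓝 x]
      fun y => exp (u (c y)) := by
    filter_upwards [hV.mem_nhds hx] with y hy
    exact hφ.coordRatio_mul_comp_proj (fun y => exp (u (c y))) hy.1
  have hud := (hus x hx).mdifferentiableAt (by simp)
  obtain ⟨κ, hκ⟩ := exists_dbar_eq_mul_chart x₀ hx.2.1
  rw [h.connForm_eq_add hφ hφ' hx.1 hx, dbarLog_congr hratio, dbarLog_exp hud, hκ _ hud]
  have h1 : connForm ρ ψ φ x v = κ v * a (c x) := by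
    simp only [a, connForm, chartConnForm, Finset.mul_sum]
    refine Finset.sum_congr rfl fun j _ => ?_
    change _ = κ v * (ρ j (c.symm (c x)) * dbarLog (coordRatio φ (ψ j) ∘ c.symm) (c x) 1)
    rw [c.left_inv hx.2.1]
    by_cases hj : ρ j x = 0
    · simp [hj]
    rw [dbarLog, dbarLog, hκ _ (hφ.mdifferentiableAt_coordRatio (h.coord j) hx.1
      (h.mem_of_ne_zero hj)), Function.comp_apply, c.left_inv hx.2.1]
    ring
  have h2 : dbar ((fun y => u (c y)) ∘ c.symm) (c x) 1 = dbar u (c x) 1 := by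
    refine dbar_congr ?_ 1
    filter_upwards [c.open_target.mem_nhds (c.map_source hx.2.1)] with z hz
    simp [c.right_inv hz]
  have h3 : f (c x) = 1 := f.one_of_mem_closedBall (Metric.ball_subset_closedBall hx.2.2)
  rw [h1, h2, dbar_complex, hub, h3]
  simp

end IsCoordCover

end Connection

/-! ### The group action on coordinates and the invariance of the averaged operator. -/

section Action

open Complex Set Filter Topology

variable {S : Type u} [TopologicalSpace S] [ChartedSpace ℂ S]
  {L : S → Type v} [∀ x, AddCommGroup (L x)] [∀ x, Module ℂ (L x)]
  {G : Type w} [Group G] [MulAction G S] [MulAction G (TotalSpace ℂ L)]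

open Classical in
variable (L) in
/-- The automorphism of `ℂ` over which `g` acts on the fibres of `L`. -/
noncomputable def fiberConj (g : G) : ℂ →+* ℂ :=
  if ActsAntilinearly L g then starRingEnd ℂ else RingHom.id ℂ

theorem fiberConj_cases (g : G) :
    (ActsAntilinearly L g ∧ fiberConj L g = starRingEnd ℂ) ∨
      (¬ ActsAntilinearly L g ∧ fiberConj L g = RingHom.id ℂ) := by
  by_cases h : ActsAntilinearly L g
  · exact Or.inl ⟨h, if_pos h⟩
  · exact Or.inr ⟨h, if_neg h⟩

theorem contDiff_fiberConj (g : G) : ContDiff ℝ ∞ (fiberConj L g) := by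
  obtain ⟨-, h⟩ | ⟨-, h⟩ := fiberConj_cases (L := L) g
  · rw [h]; exact conjCLE.contDiff
  · rw [h]; exact contDiff_id

theorem fiberConj_ofReal (g : G) (r : ℝ) : fiberConj L g r = r := by
  obtain ⟨-, h⟩ | ⟨-, h⟩ := fiberConj_cases (L := L) g <;> simp [h]

/-- The translate of a fibre coordinate by `g`. -/
noncomputable def translateCoord (g : G) (φ : TotalSpace ℂ L → ℂ) (p : TotalSpace ℂ L) : ℂ :=
  fiberConj L g (φ (g⁻¹ • p))

variable [∀ x, TopologicalSpace (L x)] [TopologicalSpace (TotalSpace ℂ L)] [FiberBundle ℂ L]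

namespace IsSmoothKleinAction

/-- Treats the linear and antilinear cases at once; injectivity on fibres comes from that of `g` on
the total space. -/
theorem exists_semilinear (hL : IsSmoothKleinAction G L) (g : G) (x : S) : ∃ T : L x → L (g • x),
    (∀ y, g • (⟨x, y⟩ : TotalSpace ℂ L) = ⟨g • x, T y⟩) ∧ (∀ y z, T (y + z) = T y + T z) ∧
      (∀ (c : ℂ) y, T (c • y) = fiberConj L g c • T y) ∧ ∀ y, T y = 0 → y = 0 := by
  have key : ∀ T : L x → L (g • x), (∀ y, g • (⟨x, y⟩ : TotalSpace ℂ L) = ⟨g • x, T y⟩) →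
      T 0 = 0 → ∀ y, T y = 0 → y = 0 := fun T hT h0 y hy => by
    have h1 : g • (⟨x, y⟩ : TotalSpace ℂ L) = g • (⟨x, 0⟩ : TotalSpace ℂ L) := by
      rw [hT, hT, hy, h0]
    have h2 := MulAction.injective g h1
    simpa using h2
  obtain ⟨h, hg⟩ | ⟨h, hg⟩ := fiberConj_cases (L := L) g
  · obtain ⟨T, hT⟩ := h x
    exact ⟨T, hT, T.map_add, fun c y => by rw [hg, T.map_smulₛₗ], key T hT T.map_zero⟩
  · obtain ⟨T, hT⟩ := (hL.fiberwise g).resolve_right h x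
    exact ⟨T, hT, T.map_add, fun c y => by rw [hg, T.map_smul]; rfl, key T hT T.map_zero⟩

theorem proj_smul (hL : IsSmoothKleinAction G L) (g : G) (p : TotalSpace ℂ L) :
    (g • p).proj = g • p.proj := by
  obtain ⟨T, hT, -⟩ := hL.exists_semilinear g p.proj
  exact congr_arg TotalSpace.proj (hT p.2)

theorem exists_hasMFDerivAt (hL : IsSmoothKleinAction G L) (hS : IsKleinAction G S) (g : G) (x : S) :
    ∃ D : ℂ →L[ℝ] ℂ, HasMFDerivAt 𝓘(ℝ, ℂ) 𝓘(ℝ, ℂ) (fun x : S => g • x) x D ∧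
      ∀ c v : ℂ, D (c * v) = fiberConj L g c * D v := by
  obtain ⟨h, hg⟩ | ⟨h, hg⟩ := fiberConj_cases (L := L) g
  · rw [hg]
    exact ((hL.antilinear_iff g).1 h).exists_hasMFDerivAt x
  · rw [hg]
    exact (((hS g).resolve_right fun h' => h ((hL.antilinear_iff g).2 h')) x).exists_hasMFDerivAt_real

variable {φ ψ : TotalSpace ℂ L → ℂ} {U V : Set S}

theorem apply_smul_add (hL : IsSmoothKleinAction G L) (hφ : IsFiberCoord φ U) (g : G) {x : S}
    (hx : g • x ∈ U) (y z : L x) :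
    φ (g • (⟨x, y + z⟩ : TotalSpace ℂ L)) = φ (g • ⟨x, y⟩) + φ (g • ⟨x, z⟩) := by
  obtain ⟨T, hT, hadd, -⟩ := hL.exists_semilinear g x
  rw [hT, hT, hT, hadd, hφ.map_add _ hx]

theorem apply_smul_smul (hL : IsSmoothKleinAction G L) (hφ : IsFiberCoord φ U) (g : G) {x : S}
    (hx : g • x ∈ U) (c : ℂ) (y : L x) :
    φ (g • (⟨x, c • y⟩ : TotalSpace ℂ L)) = fiberConj L g c * φ (g • ⟨x, y⟩) := by
  obtain ⟨T, hT, -, hsmul, -⟩ := hL.exists_semilinear g x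
  rw [hT, hT, hsmul, hφ.map_smul _ hx]

theorem eq_zero_of_apply_smul (hL : IsSmoothKleinAction G L) (hφ : IsFiberCoord φ U) (g : G) {x : S}
    (hx : g • x ∈ U) (y : L x) (h : φ (g • (⟨x, y⟩ : TotalSpace ℂ L)) = 0) : y = 0 := by
  obtain ⟨T, hT, -, -, h0⟩ := hL.exists_semilinear g x
  rw [hT] at h
  exact h0 y (hφ.eq_zero _ hx _ h)

variable [VectorBundle ℂ ℂ L] [ContMDiffVectorBundle ∞ ℂ L 𝓘(ℝ, ℂ)]

/-- The base action is recovered by moving the zero section and projecting. -/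
theorem contMDiff_smul_base (hL : IsSmoothKleinAction G L) (g : G) :
    ContMDiff 𝓘(ℝ, ℂ) 𝓘(ℝ, ℂ) ∞ (fun x : S => g • x) := by
  have h := (contMDiff_proj (IB := 𝓘(ℝ, ℂ)) (n := ∞) L).comp ((hL.smooth g).comp
    (contMDiff_zeroSection (IB := 𝓘(ℝ, ℂ)) (n := ∞) ℝ L))
  refine h.congr fun x => ?_
  exact (hL.proj_smul g (zeroSection ℂ L x)).symm

theorem coordRatio_translateCoord_aux (hL : IsSmoothKleinAction G L) (hφ : IsFiberCoord φ U)
    (hψ : IsFiberCoord ψ V) (g : G) {x : S} (hx : g • x ∈ U) (hx' : g • x ∈ V) :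
    φ (g • ⟨x, unitVec L x⟩) = coordRatio φ ψ (g • x) * ψ (g • ⟨x, unitVec L x⟩) := by
  obtain ⟨T, hT, -⟩ := hL.exists_semilinear g x
  rw [hT, hφ.eq_coordRatio_mul hψ hx hx']

theorem coordRatio_translateCoord (hL : IsSmoothKleinAction G L) (hφ : IsFiberCoord φ U)
    (hψ : IsFiberCoord ψ V) (g : G) {x : S} (hx : g⁻¹ • x ∈ U) (hx' : g⁻¹ • x ∈ V) :
    coordRatio (translateCoord g φ) (translateCoord g ψ) x =
      fiberConj L g (coordRatio φ ψ (g⁻¹ • x)) := by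
  have h0 : ψ (g⁻¹ • ⟨x, unitVec L x⟩) ≠ 0 := fun h =>
    unitVec_ne_zero x (hL.eq_zero_of_apply_smul hψ g⁻¹ hx' _ h)
  rw [coordRatio, translateCoord, translateCoord, ← map_div₀,
    hL.coordRatio_translateCoord_aux hφ hψ g⁻¹ hx hx', mul_div_cancel_right₀ _ h0]

variable [Nonempty S]

/-- Computing a coordinate of `(g * h) • (c • y)` in two ways and cancelling a nonzero value
compares the scalars. A point is needed: over an empty base every element would count as antilinear.
-/
theorem fiberConj_mul (hL : IsSmoothKleinAction G L) (g h : G) (c : ℂ) :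
    fiberConj L (g * h) c = fiberConj L g (fiberConj L h c) := by
  obtain ⟨x⟩ := ‹Nonempty S›
  have hφ := isFiberCoord_trivializationAt (L := L) ((g * h) • x)
  set φ : TotalSpace ℂ L → ℂ := fun p => (trivializationAt ℂ L ((g * h) • x) p).2
  have hx : (g * h) • x ∈ (trivializationAt ℂ L ((g * h) • x)).baseSet :=
    FiberBundle.mem_baseSet_trivializationAt' _
  have h1 := hL.apply_smul_smul hφ (g * h) hx c (unitVec L x)
  have h0 : φ ((g * h) • ⟨x, unitVec L x⟩) ≠ 0 := fun h =>
    unitVec_ne_zero x (hL.eq_zero_of_apply_smul hφ _ hx _ h)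
  obtain ⟨T, hT, -, hsmul, -⟩ := hL.exists_semilinear h x
  rw [mul_smul, mul_smul, hT, hT, hsmul,
    hL.apply_smul_smul hφ g (by simpa [mul_smul] using hx)] at h1
  rw [mul_smul, hT] at h0
  exact (mul_right_cancel₀ h0 h1).symm

theorem fiberConj_one (hL : IsSmoothKleinAction G L) (c : ℂ) : fiberConj L (1 : G) c = c := by
  have h := hL.fiberConj_mul 1 1 c
  rw [one_mul] at h
  exact ((fiberConj L (1 : G)).injective h).symm

theorem translateCoord_translateCoord (hL : IsSmoothKleinAction G L) (g h : G)
    (φ : TotalSpace ℂ L → ℂ) :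
    translateCoord g (translateCoord h φ) = translateCoord (g * h) φ := by
  ext p
  rw [translateCoord, translateCoord, translateCoord, hL.fiberConj_mul, mul_inv_rev, mul_smul]

/-- The conjugation built into the translate undoes the semilinearity of `g⁻¹`, leaving a complex
linear coordinate. -/
theorem isFiberCoord_translateCoord (hL : IsSmoothKleinAction G L) (hφ : IsFiberCoord φ U) (g : G) :
    IsFiberCoord (translateCoord g φ) ((fun x => g⁻¹ • x) ⁻¹' U) where
  isOpen := hφ.isOpen.preimage (hL.contMDiff_smul_base g⁻¹).continuous
  map_add x hx y z := by
    rw [translateCoord, hL.apply_smul_add hφ g⁻¹ hx, map_add]; rfl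
  map_smul x hx c y := by
    rw [translateCoord, hL.apply_smul_smul hφ g⁻¹ hx, map_mul, ← hL.fiberConj_mul, mul_inv_cancel,
      hL.fiberConj_one]; rfl
  eq_zero x hx y h :=
    hL.eq_zero_of_apply_smul hφ g⁻¹ hx y ((map_eq_zero (fiberConj L g)).1 h)
  smooth p hp := by
    refine ContMDiffAt.contMDiffWithinAt ?_
    refine (contDiff_fiberConj g).contDiffAt.comp_contMDiffAt ?_
    refine ContMDiffAt.comp p (hφ.contMDiffAt_of_mem ?_) (hL.smooth g⁻¹ p)
    rw [hL.proj_smul]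
    exact hp

section Orbit

variable [Fintype G] {K : Type*} [Fintype K] {ρ : K → S → ℝ} {χ : K → TotalSpace ℂ L → ℂ}
  {W : K → Set S}

/-- For each group element the translated weights sum to `1 / |G|`. -/
theorem isCoordCover_orbit (hL : IsSmoothKleinAction G L) (h : IsCoordCover ρ χ W) :
    IsCoordCover (fun (j : K × G) x => ρ j.1 (j.2⁻¹ • x) / Fintype.card G)
      (fun j => translateCoord j.2 (χ j.1)) (fun j => (fun x => j.2⁻¹ • x) ⁻¹' W j.1) where
  coord j := hL.isFiberCoord_translateCoord (h.coord j.1) j.2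
  smooth j := by
    have h1 := (h.smooth j.1).comp (hL.contMDiff_smul_base j.2⁻¹)
    exact (contDiff_id.div_const (Fintype.card G : ℝ)).contMDiff.comp h1
  support j := by
    refine (closure_minimal ?_ ((isClosed_tsupport (ρ j.1)).preimage
      (hL.contMDiff_smul_base j.2⁻¹).continuous)).trans (preimage_mono (h.support j.1))
    intro x hx
    refine subset_tsupport _ fun h0 => hx ?_
    simp [h0]
  sum_eq_one x := by
    rw [Fintype.sum_prod_type_right]
    simp_rw [← Finset.sum_div, h.sum_eq_one]
    simp

/-- Translates of flat fibre coordinates are flat. -/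
theorem connForm_translateCoord (hL : IsSmoothKleinAction G L) (hS : IsKleinAction G S)
    (h : IsCoordCover ρ χ W) (hφ : IsFiberCoord φ U) (g : G) {x : S} (hx : g⁻¹ • x ∈ U)
    (hflat : ∀ v, connForm (fun (j : K × G) x => ρ j.1 (j.2⁻¹ • x) / Fintype.card G)
      (fun j => translateCoord j.2 (χ j.1)) φ (g⁻¹ • x) v = 0) (v : ℂ) :
    connForm (fun (j : K × G) x => ρ j.1 (j.2⁻¹ • x) / Fintype.card G)
      (fun j => translateCoord j.2 (χ j.1)) (translateCoord g φ) x v = 0 := by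
  have h' := hL.isCoordCover_orbit (G := G) h
  obtain ⟨D, hD, hDl⟩ := hL.exists_hasMFDerivAt hS g⁻¹ x
  rw [← map_zero (fiberConj L g), ← hflat (D v), connForm, connForm, map_sum,
    -- Left multiplication by `g` permutes the orbit cover; this reindexing is the invariance, and
    -- terms are then matched one by one.
    ← Equiv.sum_comp (Equiv.prodCongr (Equiv.refl K) (Equiv.mulLeft g))]
  refine Finset.sum_congr rfl fun j _ => ?_
  simp only [Equiv.prodCongr_apply, Prod.map, Equiv.coe_refl, id, Equiv.coe_mulLeft, mul_inv_rev,
    mul_smul, map_mul, fiberConj_ofReal]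
  by_cases hj : ρ j.1 (j.2⁻¹ • g⁻¹ • x) / Fintype.card G = 0
  · simp [hj]
  congr 1
  have hxj := h'.mem_of_ne_zero (j := j) (x := g⁻¹ • x) hj
  have hψ := h'.coord j
  rw [← hL.translateCoord_translateCoord]
  set ψ := translateCoord j.2 (χ j.1)
  have hr : coordRatio (translateCoord g φ) (translateCoord g ψ) =ᶠ[𝓝 x]
      fun y => fiberConj L g (coordRatio φ ψ (g⁻¹ • y)) := by
    filter_upwards [(hL.contMDiff_smul_base g⁻¹).continuous.continuousAt.preimage_mem_nhds
      ((hφ.isOpen.inter hψ.isOpen).mem_nhds ⟨hx, hxj⟩)] with y hy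
    exact hL.coordRatio_translateCoord hφ hψ g hy.1 hy.2
  rw [dbarLog_congr hr]
  have hR := hφ.mdifferentiableAt_coordRatio hψ hx hxj
  -- Both possible values of `fiberConj` are involutions, so `g` and `g⁻¹` have the same one.
  have hinv : ∀ c, fiberConj L g⁻¹ c = fiberConj L g c := fun c => by
    have h2 : fiberConj L g (fiberConj L g c) = c := by
      obtain ⟨-, h⟩ | ⟨-, h⟩ := fiberConj_cases (L := L) g <;> simp [h]
    have h4 := hL.fiberConj_mul g⁻¹ g (fiberConj L g c)
    rw [inv_mul_cancel, hL.fiberConj_one, h2] at h4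
    exact h4.symm
  simp only [hinv] at hDl
  rw [dbarLog, dbarLog, map_div₀]
  congr 1
  obtain ⟨-, hg⟩ | ⟨-, hg⟩ := fiberConj_cases (L := L) g
  · rw [hg] at hDl ⊢
    exact dbar_conj_comp hR hD hDl v
  · rw [hg] at hDl ⊢
    exact dbar_comp hR hD hDl v

end Orbit

end IsSmoothKleinAction

theorem exists_isCoordCover [T2Space S] [CompactSpace S] [IsManifold 𝓘(ℂ, ℂ) ω S]
    [VectorBundle ℂ ℂ L] [ContMDiffVectorBundle ∞ ℂ L 𝓘(ℝ, ℂ)] :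
    ∃ (t : Finset S) (ρ : t → S → ℝ) (χ : t → TotalSpace ℂ L → ℂ) (W : t → Set S),
      IsCoordCover ρ χ W := by
  have : IsManifold 𝓘(ℝ, ℂ) ∞ S := isManifold_real_of_complex S
  obtain ⟨t, ht⟩ := isCompact_univ.elim_finite_subcover
    (fun x : S => (trivializationAt ℂ L x).baseSet) (fun x => (trivializationAt ℂ L x).open_baseSet)
    fun x _ => mem_iUnion.2 ⟨x, FiberBundle.mem_baseSet_trivializationAt' x⟩
  obtain ⟨f, hf⟩ := SmoothPartitionOfUnity.exists_isSubordinate 𝓘(ℝ, ℂ) (isClosed_univ (X := S))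
    (fun x : t => (trivializationAt ℂ L x.1).baseSet)
    (fun x => (trivializationAt ℂ L x.1).open_baseSet) (by simpa [iUnion_subtype] using ht)
  refine ⟨t, fun i => f i, fun i p => (trivializationAt ℂ L i.1 p).2, _,
    fun i => isFiberCoord_trivializationAt i.1, fun i => (f i).contMDiff, hf, fun x => ?_⟩
  rw [← finsum_eq_sum_of_fintype]
  exact f.sum_eq_one (mem_univ x)

end Action

/-! ### Criteria for holomorphy and antiholomorphy on the total space. -/

section TotalSpaceMaps

open Complex Set Filter Topology

theorem HasMFDerivAt.hasFDerivAt_extChartAt {M M' : Type*} [TopologicalSpace M] [ChartedSpace ℂ M]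
    [TopologicalSpace M'] [ChartedSpace ℂ M'] {g : M → M'} {x : M} {D : ℂ →L[ℝ] ℂ}
    (h : HasMFDerivAt 𝓘(ℝ, ℂ) 𝓘(ℝ, ℂ) g x D) :
    HasFDerivAt (fun z => extChartAt 𝓘(ℂ, ℂ) (g x) (g ((extChartAt 𝓘(ℂ, ℂ) x).symm z))) D
      (extChartAt 𝓘(ℂ, ℂ) x x) := by
  have h2 : HasFDerivWithinAt (fun z => extChartAt 𝓘(ℂ, ℂ) (g x)
      (g ((extChartAt 𝓘(ℂ, ℂ) x).symm z))) D univ (extChartAt 𝓘(ℂ, ℂ) x x) := by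
    rw [← range_id]
    exact h.2
  exact hasFDerivWithinAt_univ.1 h2

variable {S : Type u} [TopologicalSpace S] [ChartedSpace ℂ S]
  {L : S → Type v} [∀ x, TopologicalSpace (L x)] [TopologicalSpace (TotalSpace ℂ L)]
  [FiberBundle ℂ L] {f : TotalSpace ℂ L → TotalSpace ℂ L} {f₀ : S → S}

theorem mdifferentiable_totalSpace_of_eq_mul (hproj : ∀ p, (f p).proj = f₀ p.proj)
    (hf₀ : MDifferentiable 𝓘(ℂ, ℂ) 𝓘(ℂ, ℂ) f₀)
    (hf : ∀ x₀, ∃ m : S → ℂ, MDifferentiableAt 𝓘(ℂ, ℂ) 𝓘(ℂ, ℂ) m x₀ ∧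
      ∀ᶠ x in 𝓝 x₀, ∀ y : L x, (trivializationAt ℂ L (f₀ x₀) (f ⟨x, y⟩)).2 =
        m x * (trivializationAt ℂ L x₀ ⟨x, y⟩).2) :
    MDifferentiable (𝓘(ℂ, ℂ).prod 𝓘(ℂ, ℂ)) (𝓘(ℂ, ℂ).prod 𝓘(ℂ, ℂ)) f := by
  intro p
  have hp := mdifferentiableAt_proj (IB := 𝓘(ℂ, ℂ)) L (p := p)
  refine (mdifferentiableAt_totalSpace _ f).2 ⟨?_, ?_⟩
  · simp_rw [hproj]
    exact (hf₀ p.proj).comp p hp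
  · obtain ⟨m, hm, he⟩ := hf p.proj
    have h2 := ((mdifferentiableAt_totalSpace (IM := 𝓘(ℂ, ℂ).prod 𝓘(ℂ, ℂ)) 𝓘(ℂ, ℂ) id (x₀ := p)).1
      mdifferentiableAt_id).2
    refine ((hm.comp p hp).mul h2).congr_of_eventuallyEq ?_
    filter_upwards [(FiberBundle.continuous_proj ℂ L).continuousAt.eventually he] with q hq
    rw [hproj]
    exact hq q.2

/-- The factor is a holomorphic `m` evaluated at `f₀ x`, so its antiholomorphy in `x` comes from
`f₀`. -/
theorem mantiholomorphic_totalSpace_of_eq_mul_conj (hc : Continuous f)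
    (hproj : ∀ p, (f p).proj = f₀ p.proj) (hf₀ : MAntiholomorphic 𝓘(ℂ, ℂ) 𝓘(ℂ, ℂ) f₀)
    (hf : ∀ x₀, ∃ m : S → ℂ, MDifferentiableAt 𝓘(ℂ, ℂ) 𝓘(ℂ, ℂ) m (f₀ x₀) ∧
      ∀ᶠ x in 𝓝 x₀, ∀ y : L x, (trivializationAt ℂ L (f₀ x₀) (f ⟨x, y⟩)).2 =
        m (f₀ x) * conj (trivializationAt ℂ L x₀ ⟨x, y⟩).2) :
    MAntiholomorphic (𝓘(ℂ, ℂ).prod 𝓘(ℂ, ℂ)) (𝓘(ℂ, ℂ).prod 𝓘(ℂ, ℂ)) f := by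
  intro p
  refine ⟨hc.continuousAt, ?_⟩
  obtain ⟨m, hm, he⟩ := hf p.proj
  obtain ⟨D, hD, hDl⟩ := hf₀.exists_hasMFDerivAt p.proj
  obtain ⟨D₁, hD₁, hDl₁⟩ := hm.exists_hasMFDerivAt_real
  set c := extChartAt 𝓘(ℂ, ℂ) p.proj with hcdef
  set c' := extChartAt 𝓘(ℂ, ℂ) (f₀ p.proj) with hcdef'
  have hx : p.proj ∈ (trivializationAt ℂ L p.proj).baseSet :=
    FiberBundle.mem_baseSet_trivializationAt' _
  have hpt : extChartAt (𝓘(ℂ, ℂ).prod 𝓘(ℂ, ℂ)) p p =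
      (c p.proj, (trivializationAt ℂ L p.proj p).2) := by
    rw [FiberBundle.extChartAt]
    simp [hcdef]
  have hA : HasFDerivAt (fun z => c' (f₀ (c.symm z))) D (c p.proj) := hD.hasFDerivAt_extChartAt
  have hB : HasFDerivAt (fun z => m (f₀ (c.symm z))) (D₁.comp D) (c p.proj) := 
    (hD₁.comp p.proj hD).hasFDerivAt_extChartAt
  set w := (trivializationAt ℂ L p.proj p).2
  have hB' : HasFDerivAt (fun q : ℂ × ℂ => m (f₀ (c.symm q.1)))
      ((D₁.comp D).comp (ContinuousLinearMap.fst ℝ ℂ ℂ)) (c p.proj, w) :=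
    HasFDerivAt.comp (g := fun z => m (f₀ (c.symm z))) (c p.proj, w) hB hasFDerivAt_fst
  have hC : HasFDerivAt (fun q : ℂ × ℂ => conj q.2)
      ((conjCLE : ℂ →L[ℝ] ℂ).comp (ContinuousLinearMap.snd ℝ ℂ ℂ)) (c p.proj, w) :=
    HasFDerivAt.comp (c p.proj, w) conjCLE.hasFDerivAt hasFDerivAt_snd
  have hA' : HasFDerivAt (fun q : ℂ × ℂ => c' (f₀ (c.symm q.1)))
      (D.comp (ContinuousLinearMap.fst ℝ ℂ ℂ)) (c p.proj, w) :=
    HasFDerivAt.comp (g := fun z => c' (f₀ (c.symm z))) (c p.proj, w) hA hasFDerivAt_fst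
  -- In coordinates the map is `(z, w) ↦ (f₀ z, m (f₀ z) · conj w)`; this is its differential by the
  -- product rule, and each summand is conjugate-linear.
  refine ⟨_, ?_, HasFDerivAt.hasFDerivWithinAt (f' := (D.comp (ContinuousLinearMap.fst ℝ ℂ ℂ)).prod
    (m (f₀ (c.symm (c p.proj))) • (conjCLE : ℂ →L[ℝ] ℂ).comp (ContinuousLinearMap.snd ℝ ℂ ℂ) +
      conj w • (D₁.comp D).comp (ContinuousLinearMap.fst ℝ ℂ ℂ))) ?_⟩
  · intro a y
    have h1 : D (a * y.1) = conj a * D y.1 := hDl a y.1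
    have h2 : D₁ (D (a * y.1)) = conj a * D₁ (D y.1) := by rw [h1, hDl₁]
    refine Prod.ext h1 ?_
    change m _ * conj (a * y.2) + conj w * D₁ (D (a * y.1)) =
      conj a * (m _ * conj y.2 + conj w * D₁ (D y.1))
    rw [h2, map_mul]
    ring
  · rw [hpt]
    refine (hA'.prodMk (hB'.mul hC)).congr_of_eventuallyEq ?_
    have h1 : ∀ᶠ z in 𝓝 (c p.proj), z ∈ c.target :=
      extChartAt_target_mem_nhds (I := 𝓘(ℂ, ℂ)) p.proj
    have h2 := (continuousAt_extChartAt_symm (I := 𝓘(ℂ, ℂ)) p.proj)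
    rw [ContinuousAt, extChartAt_to_inv (I := 𝓘(ℂ, ℂ)) p.proj] at h2
    have h4 : ∀ᶠ x in 𝓝 p.proj, f₀ x ∈ (trivializationAt ℂ L (f₀ p.proj)).baseSet :=
      hD.1.eventually ((trivializationAt ℂ L (f₀ p.proj)).open_baseSet.mem_nhds
        (FiberBundle.mem_baseSet_trivializationAt' _))
    have h3 := h2.eventually ((he.and
      ((trivializationAt ℂ L p.proj).open_baseSet.mem_nhds hx)).and h4)
    filter_upwards [continuous_fst.continuousAt.eventually (h1.and h3)] with q hq
    obtain ⟨hq1, ⟨hq2, hq3⟩, hq4⟩ := hq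
    change c.symm q.1 ∈ (trivializationAt ℂ L p.proj).baseSet at hq3
    have hs : (extChartAt (𝓘(ℂ, ℂ).prod 𝓘(ℂ, ℂ)) p).symm q =
        (trivializationAt ℂ L p.proj).toOpenPartialHomeomorph.symm (c.symm q.1, q.2) := by
      rw [FiberBundle.extChartAt]; rfl
    have ht : (c.symm q.1, q.2) ∈ (trivializationAt ℂ L p.proj).target :=
      (trivializationAt ℂ L p.proj).mem_target.2 hq3
    rw [writtenInExtChartAt, Function.comp_apply, Function.comp_apply, hs, FiberBundle.extChartAt]
    set r := (trivializationAt ℂ L p.proj).toOpenPartialHomeomorph.symm (c.symm q.1, q.2) with hr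
    have hr1 : r.proj = c.symm q.1 := (trivializationAt ℂ L p.proj).proj_symm_apply ht
    have hr2 : trivializationAt ℂ L p.proj r = (c.symm q.1, q.2) :=
      (trivializationAt ℂ L p.proj).apply_symm_apply ht
    have he' : ∀ r : TotalSpace ℂ L, r.proj = c.symm q.1 →
        (trivializationAt ℂ L (f₀ p.proj) (f r)).2 =
          m (f₀ (c.symm q.1)) * conj (trivializationAt ℂ L p.proj r).2 := by
      rintro ⟨x, y⟩ rfl
      exact hq2 y
    have hr3 := he' r hr1
    rw [hr2] at hr3
    have hr4 : (trivializationAt ℂ L (f₀ p.proj) (f r)).1 = f₀ (c.symm q.1) := by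
      rw [Trivialization.coe_fst', hproj, hr1]
      rwa [hproj, hr1]
    rw [hproj p]
    refine Prod.ext ?_ hr3
    change c' (trivializationAt ℂ L (f₀ p.proj) (f r)).1 = _
    rw [hr4]

end TotalSpaceMaps

/-! ### Holomorphic structures from a family of trivializations. -/

section OfTrivializations

variable {S : Type u} [TopologicalSpace S] [ChartedSpace ℂ S]
  {L : S → Type v} [∀ x, AddCommGroup (L x)] [∀ x, Module ℂ (L x)]
  [∀ x, TopologicalSpace (L x)] [TopologicalSpace (TotalSpace ℂ L)]

/-- The fibre bundle structure given by a choice of a local trivialization at each point. -/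
@[reducible]
def fiberBundleOfTrivializations (T : S → Trivialization ℂ (π ℂ L))
    (hind : ∀ x, Topology.IsInducing (TotalSpace.mk (F := ℂ) (E := L) x))
    (hT : ∀ x, x ∈ (T x).baseSet) : FiberBundle ℂ L where
  totalSpaceMk_isInducing' := hind
  trivializationAtlas' := Set.range T
  trivializationAt' := T
  mem_baseSet_trivializationAt' := hT
  trivialization_mem_atlas' := Set.mem_range_self

/-- The holomorphic structure given by linear local trivializations with holomorphic coordinate
changes. -/
def holomorphicStructureOfTrivializations (T : S → Trivialization ℂ (π ℂ L))
    [hlin : ∀ x, (T x).IsLinear ℂ]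
    (hind : ∀ x, Topology.IsInducing (TotalSpace.mk (F := ℂ) (E := L) x))
    (hT : ∀ x, x ∈ (T x).baseSet) (hhol : ∀ x y, ContMDiffOn 𝓘(ℂ, ℂ) 𝓘(ℂ, ℂ →L[ℂ] ℂ) ω
      (fun z => ((T x).coordChangeL ℂ (T y) z : ℂ →L[ℂ] ℂ)) ((T x).baseSet ∩ (T y).baseSet)) :
    HolomorphicLineBundleStructure L :=
  letI := fiberBundleOfTrivializations T hind hT
  haveI : VectorBundle ℂ ℂ L :=
    { trivialization_linear' := by
        rintro _ ⟨x, rfl⟩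
        exact hlin x
      continuousOn_coordChange' := by
        rintro _ _ ⟨x, rfl⟩ ⟨y, rfl⟩
        exact (hhol x y).continuousOn }
  { fiberBundle := fiberBundleOfTrivializations T hind hT
    vectorBundle := this
    holomorphic :=
      { contMDiffOn_coordChangeL := by
          rintro _ _ ⟨x, rfl⟩ ⟨y, rfl⟩
          exact hhol x y } }

end OfTrivializations

/-! ### Holomorphic ratios give analytic coordinate changes. -/

section Holomorphic

open Set Filter Topology

variable {S : Type u} [TopologicalSpace S] [ChartedSpace ℂ S]

/-- Complex differentiability on an open subset of the plane implies analyticity; this is applied in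
a chart. -/
theorem contMDiffOn_omega_of_mdifferentiableAt [IsManifold 𝓘(ℂ, ℂ) ω S] {F : S → ℂ} {V : Set S}
    (hV : IsOpen V) (hF : ∀ x ∈ V, MDifferentiableAt 𝓘(ℂ, ℂ) 𝓘(ℂ, ℂ) F x) :
    ContMDiffOn 𝓘(ℂ, ℂ) 𝓘(ℂ, ℂ) ω F V := by
  have : IsManifold 𝓘(ℂ, ℂ) 1 S := IsManifold.of_le (n := ω) le_top
  intro x hx
  refine ContMDiffAt.contMDiffWithinAt ?_
  set c := chartAt ℂ x with hc
  have hxc : x ∈ c.source := mem_chart_source ℂ x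
  have hN : IsOpen (c.target ∩ c.symm ⁻¹' V) := c.isOpen_inter_preimage_symm hV
  have hd : DifferentiableOn ℂ (F ∘ c.symm) (c.target ∩ c.symm ⁻¹' V) := fun z hz => by
    have h1 := mdifferentiableAt_atlas_symm (I := 𝓘(ℂ, ℂ)) (chart_mem_atlas ℂ x) hz.1
    have h2 := MDifferentiableAt.comp z (hF _ hz.2) h1
    exact (mdifferentiableAt_iff_differentiableAt.1 h2).differentiableWithinAt
  have ha : ContDiffAt ℂ ω (F ∘ c.symm) (c x) :=
    (hd.analyticAt (hN.mem_nhds ⟨c.map_source hxc, by simpa [c.left_inv hxc] using hx⟩)).contDiffAt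
  refine (ha.contMDiffAt.comp x ((contMDiffOn_chart (I := 𝓘(ℂ, ℂ)) (n := ω)).contMDiffAt
    (c.open_source.mem_nhds hxc))).congr_of_eventuallyEq ?_
  filter_upwards [c.open_source.mem_nhds hxc] with y hy
  change F y = F (c.symm (c y))
  rw [c.left_inv hy]

variable {L : S → Type v} [∀ x, AddCommGroup (L x)] [∀ x, Module ℂ (L x)]
  [∀ x, TopologicalSpace (L x)] [TopologicalSpace (TotalSpace ℂ L)] [FiberBundle ℂ L]
  [VectorBundle ℂ ℂ L] [ContMDiffVectorBundle ∞ ℂ L 𝓘(ℝ, ℂ)]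

theorem IsFiberCoord.coordChangeL_toTrivialization {φ ψ : TotalSpace ℂ L → ℂ} {U V : Set S}
    (hφ : IsFiberCoord φ U) (hψ : IsFiberCoord ψ V) [hφ.toTrivialization.IsLinear ℂ]
    [hψ.toTrivialization.IsLinear ℂ] {x : S} (hx : x ∈ U ∩ V) :
    (hφ.toTrivialization.coordChangeL ℂ hψ.toTrivialization x : ℂ →L[ℂ] ℂ) =
      ContinuousLinearMap.toSpanSingleton ℂ (coordRatio ψ φ x) := by
  ext
  rw [ContinuousLinearEquiv.coe_coe, Trivialization.coordChangeL_apply' _ _ hx]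
  change ψ ⟨x, (1 / φ ⟨x, unitVec L x⟩) • unitVec L x⟩ = _
  rw [hψ.map_smul x hx.2, ContinuousLinearMap.toSpanSingleton_apply, coordRatio, one_smul]
  ring

variable {Φ : S → TotalSpace ℂ L → ℂ} {U : S → Set S}

theorem contMDiffOn_coordChangeL_toTrivialization [IsManifold 𝓘(ℂ, ℂ) ω S]
    (hΦ : ∀ x, IsFiberCoord (Φ x) (U x)) (hhol : ∀ x y z, z ∈ U x → z ∈ U y →
      MDifferentiableAt 𝓘(ℂ, ℂ) 𝓘(ℂ, ℂ) (coordRatio (Φ x) (Φ y)) z) (x y : S)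
    [(hΦ x).toTrivialization.IsLinear ℂ] [(hΦ y).toTrivialization.IsLinear ℂ] :
    ContMDiffOn 𝓘(ℂ, ℂ) 𝓘(ℂ, ℂ →L[ℂ] ℂ) ω (fun z => ((hΦ x).toTrivialization.coordChangeL ℂ
      (hΦ y).toTrivialization z : ℂ →L[ℂ] ℂ)) (U x ∩ U y) := by
  have h1 := contMDiffOn_omega_of_mdifferentiableAt ((hΦ x).isOpen.inter (hΦ y).isOpen)
    fun z hz => hhol y x z hz.2 hz.1
  have h2 : ContDiff ℂ ω fun a : ℂ => ContinuousLinearMap.toSpanSingleton ℂ a :=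
    (ContinuousLinearMap.toSpanSingletonCLE (𝕜 := ℂ) (E := ℂ)).contDiff
  exact (h2.contMDiff.comp_contMDiffOn h1).congr fun z hz =>
    (hΦ x).coordChangeL_toTrivialization (hΦ y) hz

end Holomorphic

/-! ### The action read in fibre coordinates. -/

section Equivariant

open Filter Topology

variable {S : Type u} [TopologicalSpace S] [ChartedSpace ℂ S]
  {L : S → Type v} [∀ x, AddCommGroup (L x)] [∀ x, Module ℂ (L x)]
  [∀ x, TopologicalSpace (L x)] [TopologicalSpace (TotalSpace ℂ L)] [FiberBundle ℂ L]
  [VectorBundle ℂ ℂ L] [ContMDiffVectorBundle ∞ ℂ L 𝓘(ℝ, ℂ)]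
  {G : Type w} [Group G] [MulAction G S] [MulAction G (TotalSpace ℂ L)] [Nonempty S]

/-- At `g • ⟨x, y⟩` the translate of `φ` takes the value `fiberConj L g (φ ⟨x, y⟩)`, so the factor
is a ratio of coordinates at `g • x`, as both total space criteria require. -/
theorem IsSmoothKleinAction.eventually_apply_smul (hL : IsSmoothKleinAction G L)
    {φ ψ : TotalSpace ℂ L → ℂ} {U V : Set S} (hφ : IsFiberCoord φ U) (hψ : IsFiberCoord ψ V) (g : G)
    {x₀ : S} (hx : x₀ ∈ U) (hx' : g • x₀ ∈ V) : ∀ᶠ x in 𝓝 x₀, ∀ y : L x,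
      ψ (g • ⟨x, y⟩) = coordRatio ψ (translateCoord g φ) (g • x) * fiberConj L g (φ ⟨x, y⟩) := by
  filter_upwards [hφ.isOpen.mem_nhds hx, (hL.contMDiff_smul_base g).continuous.continuousAt.eventually
    (hψ.isOpen.mem_nhds hx')] with x hxU hxV y
  obtain ⟨T, hT, -⟩ := hL.exists_semilinear g x
  have h1 := hψ.eq_coordRatio_mul (hL.isFiberCoord_translateCoord hφ g) hxV
    (by simpa using hxU) (T y)
  rw [← hT, translateCoord, inv_smul_smul] at h1
  exact h1

end Equivariant

theorem theorem4p1
    -- a (compact, connected) Riemann surface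
    (S : Type u) [TopologicalSpace S] [T2Space S] [CompactSpace S] [ConnectedSpace S]
    [ChartedSpace ℂ S] [IsManifold 𝓘(ℂ, ℂ) ω S]
    -- a smooth complex line bundle
    (L : S → Type v) [∀ x, AddCommGroup (L x)] [∀ x, Module ℂ (L x)]
    [∀ x, TopologicalSpace (L x)] [TopologicalSpace (TotalSpace ℂ L)]
    [FiberBundle ℂ L] [VectorBundle ℂ ℂ L] [ContMDiffVectorBundle ∞ ℂ L 𝓘(ℝ, ℂ)]
    -- a finite group with a faithful Klein action on the surface
    (G : Type w) [Group G] [Finite G] [MulAction G S] [FaithfulSMul G S]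
    (hS : IsKleinAction G S)
    -- and a smooth Klein action on the bundle
    [MulAction G (TotalSpace ℂ L)] (hL : IsSmoothKleinAction G L) :
    ∃ h : HolomorphicLineBundleStructure L, h.IsCompatible ∧ h.IsKleinAction G := by
  have := Fintype.ofFinite G
  obtain ⟨t, ρ, χ, W, hcover⟩ := exists_isCoordCover (L := L)
  have horbit := hL.isCoordCover_orbit hcover
  choose Φ U hxU hΦ hflat using fun x => horbit.exists_flat x
  have hhol : ∀ x y z, z ∈ U x → z ∈ U y →
      MDifferentiableAt 𝓘(ℂ, ℂ) 𝓘(ℂ, ℂ) (coordRatio (Φ x) (Φ y)) z := fun x y z hx hy =>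
    horbit.mdifferentiableAt_coordRatio_of_flat (hΦ y) (hΦ x) hy hx (hflat y z hy 1) (hflat x z hx 1)
  -- Near `g • x` both `Φ (g • x)` and the translate of `Φ x` are flat for the invariant operator.
  have htrans : ∀ (g : G) (x : S), MDifferentiableAt 𝓘(ℂ, ℂ) 𝓘(ℂ, ℂ)
      (coordRatio (Φ (g • x)) (translateCoord g (Φ x))) (g • x) := fun g x => by
    have hx : g⁻¹ • g • x ∈ U x := by rw [inv_smul_smul]; exact hxU x
    exact horbit.mdifferentiableAt_coordRatio_of_flat (hL.isFiberCoord_translateCoord (hΦ x) g)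
      (hΦ (g • x)) hx (hxU _)
      (hL.connForm_translateCoord hS hcover (hΦ x) g hx (hflat x _ hx) 1)
      (hflat _ _ (hxU _) 1)
  have hlin : ∀ x, (hΦ x).toTrivialization.IsLinear ℂ := fun x => (hΦ x).isLinear_toTrivialization
  refine ⟨holomorphicStructureOfTrivializations (fun x => (hΦ x).toTrivialization)
    (FiberBundle.totalSpaceMk_isInducing ℂ L) hxU
    (fun x y => contMDiffOn_coordChangeL_toTrivialization hΦ hhol x y), ?_, ⟨hL, fun g => ?_⟩⟩
  · rintro _ ⟨x, rfl⟩
    exact ⟨(hΦ x).contMDiffOn_toTrivialization, (hΦ x).contMDiffOn_toTrivialization_symm⟩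
  · obtain ⟨hg, hσ⟩ | ⟨hg, hσ⟩ := fiberConj_cases (L := L) g
    -- The bundle instance is passed explicitly so that the charts are those of the new holomorphic
    -- structure, not of the given smooth one.
    · refine Or.inr (@mantiholomorphic_totalSpace_of_eq_mul_conj S _ _ L _ _
        (fiberBundleOfTrivializations (fun x => (hΦ x).toTrivialization)
          (FiberBundle.totalSpaceMk_isInducing ℂ L) hxU) _ (fun x => g • x)
        (hL.smooth g).continuous (hL.proj_smul g) ((hL.antilinear_iff g).1 hg) fun x₀ =>
        ⟨_, htrans g x₀, ?_⟩)
      filter_upwards [hL.eventually_apply_smul (hΦ x₀) (hΦ (g • x₀)) g (hxU x₀) (hxU _)] with x hx y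
      rw [hσ] at hx
      exact hx y
    · have hgS := (hS g).resolve_right fun h' => hg ((hL.antilinear_iff g).2 h')
      refine Or.inl (@mdifferentiable_totalSpace_of_eq_mul S _ _ L _ _
        (fiberBundleOfTrivializations (fun x => (hΦ x).toTrivialization)
          (FiberBundle.totalSpaceMk_isInducing ℂ L) hxU) _ (fun x => g • x)
        (hL.proj_smul g) hgS fun x₀ =>
        -- Here `g` is holomorphic on the base, so the factor stays holomorphic when pulled back to
        -- `x₀`.
        ⟨_, (htrans g x₀).comp x₀ (hgS x₀), ?_⟩)
      filter_upwards [hL.eventually_apply_smul (hΦ x₀) (hΦ (g • x₀)) g (hxU x₀) (hxU _)] with x hx y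
      rw [hσ] at hx
      exact hx y
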